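/- **Setting.** Groups $i=1,2,\dots$ have i.i.d. data: a group size $s_i\in\mathbb N$, covariates $X_i=(X_{i1},\dots,X_{is_i})$, $X_{ik}\in\mathbb R^d$, and outcomes $Y_i\in\mathbb R^{s_i}$. A mean function $\mu(x,b)$ and a working covariance matrix $V(X_i,b)$, $b\in\mathbb R^p$, are given, and $\mathbb E(Y_{ik}\mid X_i)=\mu(X_{ik},\beta)$ for the true $\beta\in\mathbb R^p$; the true covariance of $Y_i$ is unrestricted. Let $\mu_i(b)=(\mu(X_{ik},b))_k$, $D_i(b)=\partial\mu_i(b)/\partial b$, $V_i(b)=V(X_i,b)$ and $\psi_i(b)=D_i(b)^TV_i(b)^{-1}(Y_i-\mu_i(b))$, with Jacobian $\dot\psi_i(b)$. Near $\beta$, $\mu$ is $C^2$ in $b$, and $V$ is $C^1$ in $b$ and positive definite. The entries of $\psi_i(b)$, $D_i^TV_i^{-1}D_i(b)$ and $D_i^TV_i^{-1}(Y_i-\mu_i)(Y_i-\mu_i)^TV_i^{-1}D_i(b)$ are $C^2$ near $\beta$, have finite expectation and gradient of finite expectation at $\beta$, and have Hessians dominated near $\beta$ by a variable of finite expectation; and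 $\mathbb E\{D_i^TV_i^{-1}D_i(\beta)\}$ is invertible. There are $M$ analyses, and $n=n_M$ groups (a non-random number) at the last one; limits are as $n\to\infty$. Let $\xi_{im}\in\{0,1\}$ indicate that group $i\le n$ has arrived by analysis $m$; $\xi_{im}$ is nondecreasing in $m$, $\xi_{iM}=1$, the arrivals are independent of the data, and $\pi_m=\mathbb E(\xi_{im})$ does not depend on $i$ and has a positive limit as $n\to\infty$. Let $n_m=\sum_{i\le n}\xi_{im}$. Suppose that either the arrivals of different groups are independent, or every $n_m$ is non-random (in which case $\pi_m=n_m/n$). Define the estimands, as limits in probability, for $k,r,m\in\{1,\dots,M\}$, by $$\Omega_m=-\lim_n\frac1n\sum_{i=1}^n\xi_{im}\mathbb E\{\dot\psi_i(\beta)\mid X_i\},\qquad \Lambda_{kr}=\lim_n\frac1n\sum_{i=1}^n\xi_{ik}\xi_{ir}\mathbb E\{\psi_i(\beta)\psi_i(\beta)^T\mid X_i\},$$ and $\boldsymbol\Omega=\mathrm{diag}(\Omega_1,\dots,\Omega_M)$, $\boldsymbol\Lambda=(\Lambda_{kr})_{k,r}$, $\boldsymbol\Sigma=\boldsymbol\Omega^{-1}\boldsymbol\Lambda\boldsymbol\Omega^{-T}$,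 the $Mp\times Mp$ joint covariance matrix of the stacked sequential estimators. Let $\hat{\boldsymbol\beta}=(\hat\beta_1^T,\dots,\hat\beta_M^T)^T$ be the stacked sequential GEE estimators: with probability tending to one, $\sum_{i=1}^n\xi_{im}\psi_i(\hat\beta_m)=0$ for every $m$, and each $\hat\beta_m$ lies in a certain fixed neighbourhood $U$ of $\beta$ (see below). Put $\hat D_{im}=D_i(\hat\beta_m)$, $\hat V_{im}=V_i(\hat\beta_m)$, $\hat e_{im}=Y_i-\mu_i(\hat\beta_m)$, and $$\hat\Omega_m=\frac1n\sum_{i=1}^n\xi_{im}\hat D_{im}^T\hat V_{im}^{-1}\hat D_{im},\qquad \hat\Lambda_{mm}=\frac1n\sum_{i=1}^n\xi_{im}\hat D_{im}^T\hat V_{im}^{-1}\hat e_{im}\hat e_{im}^T\hat V_{im}^{-1}\hat D_{im},$$ while $\hat\Omega^*_m$ and $\hat\Lambda^*_m$ are the averages of the same summands over the $n_m$ groups that have arrived by analysis $m$. Let $\tilde\Omega_m=\pi_m\hat\Omega^*_m$ and $\tilde\Lambda_{mm}=\pi_m\hat\Lambda^*_m$. **Theorem 1.** The limits $\Omega_m$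 and $\Lambda_{kr}$ exist, $\boldsymbol\Omega$ is invertible, and there is a neighbourhood $U$ of $\beta$ such that, for all estimators $\hat{\boldsymbol\beta}$ as above (in particular for every consistent sequence of solutions) and every $m=1,\dots,M$: 1. $\tilde\Omega_m$ and $\hat\Omega_m$ converge in probability to the same limit, namely $\Omega_m$, and $\tilde\Lambda_{mm}$ and $\hat\Lambda_{mm}$ converge in probability to the same limit, namely $\Lambda_{mm}$. 2. For $1\le r\le k\le M$, the matrices $\hat\Omega^{(m)}_r=\frac{n_r}{n_m}\tilde\Omega_m$, $\hat\Lambda^{(m)}_{kr}=\frac{n_r}{n_m}\tilde\Lambda_{mm}$ and $\hat\Lambda^{(m)}_{rk}=\{\hat\Lambda^{(m)}_{kr}\}^T$ are consistent for $\Omega_r$, $\Lambda_{kr}$ and $\Lambda_{rk}$, respectively. 3. $\hat{\boldsymbol\Omega}^{(m)}=\mathrm{diag}(\hat\Omega^{(m)}_1,\dots,\hat\Omega^{(m)}_M)$ and $\hat{\boldsymbol\Lambda}^{(m)}=(\hat\Lambda^{(m)}_{kr})_{k,r}$ are consistent for $\boldsymbol\Omega$ and $\boldsymbol\Lambda$,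 and $\hat{\boldsymbol\Sigma}^{(m)}=\{\hat{\boldsymbol\Omega}^{(m)}\}^{-1}\hat{\boldsymbol\Lambda}^{(m)}\{\hat{\boldsymbol\Omega}^{(m)}\}^{-T}$ is consistent for $\boldsymbol\Sigma$. -/

import Mathlib

open MeasureTheory ProbabilityTheory Filter Topology Matrix

/-- The data of one group: its size `s`, the covariate vectors of its `s` observations (each in
`ℝ^d`), and its outcome vector with `s` components. Sizes may differ between groups. -/
abbrev GroupData (d : ℕ) : Type := Σ s : ℕ, (Fin s → Fin d → ℝ) × (Fin s → ℝ)

/-- The covariates of a group (the matrix `X_i`, together with its number of rows). -/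
def GroupData.cov {d : ℕ} (z : GroupData d) : Σ s : ℕ, (Fin s → Fin d → ℝ) := ⟨z.1, z.2.1⟩

theorem GroupData.measurable_cov {d : ℕ} : Measurable (GroupData.cov (d := d)) := by
  refine measurable_iff_comap_le.2 ?_
  rintro _ ⟨t, ht, rfl⟩
  refine MeasurableSpace.measurableSet_iInf.2 fun s => ?_
  have hs : MeasurableSet ((fun x : Fin s → Fin d → ℝ =>
      (⟨s, x⟩ : Σ s : ℕ, (Fin s → Fin d → ℝ))) ⁻¹' t) :=
    MeasurableSpace.measurableSet_iInf.1 ht s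
  exact (measurable_fst : Measurable
    (Prod.fst : (Fin s → Fin d → ℝ) × (Fin s → ℝ) → (Fin s → Fin d → ℝ))) hs

/-- A generalized estimating equation model: the mean function `μ(x, b)` of an observation and the
working covariance matrix `V(X, b)` of the outcome vector of a group of size `s`. -/
structure GEEModel (d p : ℕ) where
  mean : (Fin d → ℝ) → (Fin p → ℝ) → ℝ
  V : (s : ℕ) → (Fin s → Fin d → ℝ) → (Fin p → ℝ) → Matrix (Fin s) (Fin s) ℝ

namespace GEEModel

variable {d p : ℕ}

/-- `D(X, b)`: the Jacobian of `b ↦ (μ(X_1, b), …, μ(X_s, b))`. -/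
noncomputable def D (G : GEEModel d p) (b : Fin p → ℝ) (z : GroupData d) :
    Matrix (Fin z.1) (Fin p) ℝ :=
  Matrix.of fun k j => fderiv ℝ (G.mean (z.2.1 k)) b (Pi.single j 1)

/-- The residual vector `Y - μ(X, b)`. -/
def resid (G : GEEModel d p) (b : Fin p → ℝ) (z : GroupData d) : Fin z.1 → ℝ :=
  fun k => z.2.2 k - G.mean (z.2.1 k) b

/-- The `k`-th residual, and `0` when the group has no `k`-th observation. -/
noncomputable def residAt (G : GEEModel d p) (b : Fin p → ℝ) (k : ℕ) (z : GroupData d) : ℝ :=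
  if h : k < z.1 then G.resid b z ⟨k, h⟩ else 0

/-- The estimating function `ψ(X; b) = Dᵀ V⁻¹ (Y - μ)`. -/
noncomputable def score (G : GEEModel d p) (b : Fin p → ℝ) (z : GroupData d) : Fin p → ℝ :=
  ((G.D b z)ᵀ * (G.V z.1 z.2.1 b)⁻¹) *ᵥ G.resid b z

/-- The Jacobian `ψ̇(X; b)` of `ψ(X; ·)` at `b`. -/
noncomputable def scoreJac (G : GEEModel d p) (b : Fin p → ℝ) (z : GroupData d) :
    Matrix (Fin p) (Fin p) ℝ :=
  Matrix.of fun a j => fderiv ℝ (fun b' => G.score b' z a) b (Pi.single j 1)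

/-- `Dᵀ V⁻¹ D`. -/
noncomputable def info (G : GEEModel d p) (b : Fin p → ℝ) (z : GroupData d) :
    Matrix (Fin p) (Fin p) ℝ :=
  (G.D b z)ᵀ * (G.V z.1 z.2.1 b)⁻¹ * G.D b z

/-- `Dᵀ V⁻¹ (Y - μ) (Y - μ)ᵀ V⁻¹ D`. -/
noncomputable def meat (G : GEEModel d p) (b : Fin p → ℝ) (z : GroupData d) :
    Matrix (Fin p) (Fin p) ℝ :=
  (G.D b z)ᵀ * (G.V z.1 z.2.1 b)⁻¹ * vecMulVec (G.resid b z) (G.resid b z) *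
    (G.V z.1 z.2.1 b)⁻¹ * G.D b z

/-- The stacked (compound) estimating function `Ψ = (ξ_1 ψ(X; b_1), …, ξ_M ψ(X; b_M))`. -/
noncomputable def compoundScore {M : ℕ} (G : GEEModel d p) (ξ : Fin M → ℝ)
    (b : Fin M → Fin p → ℝ) (z : GroupData d) : Fin M × Fin p → ℝ :=
  fun ma => ξ ma.1 * G.score (b ma.1) z ma.2

end GEEModel

/-- `f(b, z)` is integrable at `b = β`, is twice continuously differentiable in `b` near `β`, its
gradient at `β` has finite expectation, and its Hessian is dominated near `β` by a function of
finite expectation. -/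
def LocallyDominated {d p : ℕ} (Q : Measure (GroupData d)) (β : Fin p → ℝ)
    (f : (Fin p → ℝ) → GroupData d → ℝ) : Prop :=
  Integrable (f β) Q ∧
  ∃ W ∈ 𝓝 β, ∃ H : GroupData d → ℝ, Integrable H Q ∧
    ∀ᵐ z ∂Q, ‖fderiv ℝ (fun b => f b z) β‖ ≤ H z ∧
      ∀ b ∈ W, ContDiffAt ℝ 2 (fun b => f b z) b ∧
        ‖iteratedFDeriv ℝ 2 (fun b => f b z) b‖ ≤ H z

/-- The standing assumptions on the model, for the law `Q` of one group and the true coefficient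
vector `β`. -/
structure GEEModel.Regular {d p : ℕ} (G : GEEModel d p) (Q : Measure (GroupData d))
    (β : Fin p → ℝ) : Prop where
  measurable_mean : ∀ b, Measurable fun x => G.mean x b
  measurable_V : ∀ s b k l, Measurable fun x => G.V s x b k l
  /-- The mean and the working covariance matrix are smooth in the parameter near `β`, and the
  latter is positive definite. -/
  smooth : ∃ W ∈ 𝓝 β, ∀ᵐ z ∂Q, ∀ b ∈ W,
    (∀ k, ContDiffAt ℝ 2 (G.mean (z.2.1 k)) b) ∧
    (∀ k l, ContDiffAt ℝ 1 (fun b' => G.V z.1 z.2.1 b' k l) b) ∧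
    (G.V z.1 z.2.1 b).PosDef
  /-- The mean model is correct: `E(Y_k | X) = μ(X_k, β)`. The true covariance of the outcomes is
  unrestricted. -/
  mean_correct : ∀ k : ℕ, Integrable (G.residAt β k) Q ∧
    Q[G.residAt β k | MeasurableSpace.comap GroupData.cov inferInstance] =ᵐ[Q] 0
  score_dom : ∀ a, LocallyDominated Q β fun b z => G.score b z a
  info_dom : ∀ a j, LocallyDominated Q β fun b z => G.info b z a j
  meat_dom : ∀ a j, LocallyDominated Q β fun b z => G.meat b z a j
  nonsingular : IsUnit (Matrix.of fun a j => ∫ z, G.info β z a j ∂Q).det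

section Arrival

variable {Ω : Type*} {M : ℕ}

/-- The arrival indicator `ξ_{im}` when `n` groups are enrolled in total: `A n i` is the first
analysis at which group `i` is available, so `ξ_{im} = 1` exactly when `A n i ≤ m`. In particular
`ξ_{im}` is nondecreasing in `m` and equals `1` at the last analysis. -/
def arrived (A : (n : ℕ) → Fin n → Ω → Fin M) (n : ℕ) (i : Fin n) (m : Fin M) (ω : Ω) : ℝ :=
  if A n i ω ≤ m then 1 else 0

/-- The number `n_m` of groups available at analysis `m`. -/
def numArrived (A : (n : ℕ) → Fin n → Ω → Fin M) (n : ℕ) (m : Fin M) (ω : Ω) : ℕ :=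
  (Finset.univ.filter fun i => A n i ω ≤ m).card

end Arrival

section Estimators

variable {Ω : Type*} {M d p : ℕ}

/-- `(1/n) ∑ ξ_{im} Dᵀ V⁻¹ D` at the estimate `β̂_m`. -/
noncomputable def omegaHat (G : GEEModel d p) (Z : ℕ → Ω → GroupData d)
    (A : (n : ℕ) → Fin n → Ω → Fin M) (βh : ℕ → Ω → Fin M → Fin p → ℝ) (m : Fin M) (n : ℕ)
    (ω : Ω) : Matrix (Fin p) (Fin p) ℝ :=
  (1 / (n : ℝ)) • ∑ i : Fin n, arrived A n i m ω • G.info (βh n ω m) (Z i ω)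

/-- The compound estimator `Λ̂_{mm}`. -/
noncomputable def lambdaHat (G : GEEModel d p) (Z : ℕ → Ω → GroupData d)
    (A : (n : ℕ) → Fin n → Ω → Fin M) (βh : ℕ → Ω → Fin M → Fin p → ℝ) (m : Fin M) (n : ℕ)
    (ω : Ω) : Matrix (Fin p) (Fin p) ℝ :=
  (1 / (n : ℝ)) • ∑ i : Fin n, arrived A n i m ω • G.meat (βh n ω m) (Z i ω)

/-- The standard interim matrix `Ω̂*_m`: the average of `Dᵀ V⁻¹ D` at `β̂_m` over the `n_m` groups
available at analysis `m`. -/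
noncomputable def omegaStd (G : GEEModel d p) (Z : ℕ → Ω → GroupData d)
    (A : (n : ℕ) → Fin n → Ω → Fin M) (βh : ℕ → Ω → Fin M → Fin p → ℝ) (m : Fin M) (n : ℕ)
    (ω : Ω) : Matrix (Fin p) (Fin p) ℝ :=
  (1 / (numArrived A n m ω : ℝ)) •
    ∑ i ∈ Finset.univ.filter (fun i : Fin n => A n i ω ≤ m), G.info (βh n ω m) (Z i ω)

/-- The standard interim matrix `Λ̂*_m`. -/
noncomputable def lambdaStd (G : GEEModel d p) (Z : ℕ → Ω → GroupData d)
    (A : (n : ℕ) → Fin n → Ω → Fin M) (βh : ℕ → Ω → Fin M → Fin p → ℝ) (m : Fin M) (n : ℕ)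
    (ω : Ω) : Matrix (Fin p) (Fin p) ℝ :=
  (1 / (numArrived A n m ω : ℝ)) •
    ∑ i ∈ Finset.univ.filter (fun i : Fin n => A n i ω ≤ m), G.meat (βh n ω m) (Z i ω)

/-- `Ω̃_m = π_m Ω̂*_m`. -/
noncomputable def omegaTilde (G : GEEModel d p) (Z : ℕ → Ω → GroupData d)
    (A : (n : ℕ) → Fin n → Ω → Fin M) (π : ℕ → Fin M → ℝ) (βh : ℕ → Ω → Fin M → Fin p → ℝ)
    (m : Fin M) (n : ℕ) (ω : Ω) : Matrix (Fin p) (Fin p) ℝ :=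
  π n m • omegaStd G Z A βh m n ω

/-- `Λ̃_{mm} = π_m Λ̂*_m`. -/
noncomputable def lambdaTilde (G : GEEModel d p) (Z : ℕ → Ω → GroupData d)
    (A : (n : ℕ) → Fin n → Ω → Fin M) (π : ℕ → Fin M → ℝ) (βh : ℕ → Ω → Fin M → Fin p → ℝ)
    (m : Fin M) (n : ℕ) (ω : Ω) : Matrix (Fin p) (Fin p) ℝ :=
  π n m • lambdaStd G Z A βh m n ω

/-- `Ω̂_r^{(m)} = (n_r / n_m) Ω̃_m`. -/
noncomputable def omegaInterim (G : GEEModel d p) (Z : ℕ → Ω → GroupData d)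
    (A : (n : ℕ) → Fin n → Ω → Fin M) (π : ℕ → Fin M → ℝ) (βh : ℕ → Ω → Fin M → Fin p → ℝ)
    (m r : Fin M) (n : ℕ) (ω : Ω) : Matrix (Fin p) (Fin p) ℝ :=
  ((numArrived A n r ω : ℝ) / (numArrived A n m ω : ℝ)) • omegaTilde G Z A π βh m n ω

/-- `Λ̂_{kr}^{(m)} = (n_r / n_m) Λ̃_{mm}` and `Λ̂_{rk}^{(m)} = (Λ̂_{kr}^{(m)})ᵀ` for `r ≤ k`. -/
noncomputable def lambdaInterim (G : GEEModel d p) (Z : ℕ → Ω → GroupData d)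
    (A : (n : ℕ) → Fin n → Ω → Fin M) (π : ℕ → Fin M → ℝ) (βh : ℕ → Ω → Fin M → Fin p → ℝ)
    (m k r : Fin M) (n : ℕ) (ω : Ω) : Matrix (Fin p) (Fin p) ℝ :=
  if r ≤ k then
    ((numArrived A n r ω : ℝ) / (numArrived A n m ω : ℝ)) • lambdaTilde G Z A π βh m n ω
  else
    (((numArrived A n k ω : ℝ) / (numArrived A n m ω : ℝ)) • lambdaTilde G Z A π βh m n ω)ᵀ

/-- `-(1/n) ∑ ξ_{im} E{ψ̇(X_i; β) | X_i}`, whose limit is the estimand `Ω_m`. -/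
noncomputable def omegaAverage [MeasurableSpace Ω] (P : Measure Ω) (G : GEEModel d p)
    (β : Fin p → ℝ) (Z : ℕ → Ω → GroupData d) (A : (n : ℕ) → Fin n → Ω → Fin M) (m : Fin M)
    (n : ℕ) (ω : Ω) : Matrix (Fin p) (Fin p) ℝ :=
  Matrix.of fun a j => -((1 / (n : ℝ)) * ∑ i : Fin n, arrived A n i m ω *
    (P[fun ω' => G.scoreJac β (Z i ω') a j |
      MeasurableSpace.comap (fun ω' => (Z i ω').cov) inferInstance]) ω)

/-- `(1/n) ∑ ξ_{ik} ξ_{ir} E{ψ(X_i; β) ψ(X_i; β)ᵀ | X_i}`, whose limit is the estimand `Λ_{kr}`. -/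
noncomputable def lambdaAverage [MeasurableSpace Ω] (P : Measure Ω) (G : GEEModel d p)
    (β : Fin p → ℝ) (Z : ℕ → Ω → GroupData d) (A : (n : ℕ) → Fin n → Ω → Fin M) (k r : Fin M)
    (n : ℕ) (ω : Ω) : Matrix (Fin p) (Fin p) ℝ :=
  Matrix.of fun a j => (1 / (n : ℝ)) * ∑ i : Fin n, arrived A n i k ω * arrived A n i r ω *
    (P[fun ω' => G.score β (Z i ω') a * G.score β (Z i ω') j |
      MeasurableSpace.comap (fun ω' => (Z i ω').cov) inferInstance]) ω

end Estimators

/-- Convergence in probability of random matrices, entry by entry, to a constant matrix. -/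
def ConvergesInProb {Ω : Type*} [MeasurableSpace Ω] {ι κ : Type*} (P : Measure Ω)
    (F : ℕ → Ω → Matrix ι κ ℝ) (L : Matrix ι κ ℝ) : Prop :=
  ∀ i j, TendstoInMeasure P (fun n ω => F n ω i j) atTop (fun _ => L i j)

/-- The `Mp × Mp` matrix with blocks `B k r`. -/
def blocks {M p : ℕ} (B : Fin M → Fin M → Matrix (Fin p) (Fin p) ℝ) :
    Matrix (Fin M × Fin p) (Fin M × Fin p) ℝ :=
  Matrix.of fun x y => B x.1 y.1 x.2 y.2

/-- The block-diagonal `Mp × Mp` matrix with diagonal blocks `B r`. -/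
def diagBlocks {M p : ℕ} (B : Fin M → Matrix (Fin p) (Fin p) ℝ) :
    Matrix (Fin M × Fin p) (Fin M × Fin p) ℝ :=
  Matrix.of fun x y => if x.1 = y.1 then B x.1 x.2 y.2 else 0

/-- `S⁻¹ L S⁻ᵀ`. -/
noncomputable def sandwich {ι : Type*} [Fintype ι] [DecidableEq ι] (S L : Matrix ι ι ℝ) :
    Matrix ι ι ℝ :=
  S⁻¹ * L * (S⁻¹)ᵀ

/-! Put J = E{DᵀV⁻¹D(β)}, K = E{ψ(β)ψ(β)ᵀ} and ϖ_m = lim π_m. Every limit in the theorem is built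
from scalar multiples of J and K: Ω_m = ϖ_m J and, because arrivals are nested in m, Λ_{kr} =
ϖ_{min(k,r)} K. So one interim analysis, which can estimate J and K from its own groups, determines
all blocks once the scalars are supplied by π_m and the ratios n_r/n_m.

Three ingredients make this rigorous. Averages of functions of the data, weighted by arrival
indicators, obey a weak law (`tendsto_weighted_average`) because the arrivals are independent of the
data and n_m/n tends to ϖ_m (`tendsto_average_arrived`). Correctness of the mean gives E ψ(β) = 0
and E ψ̇(β) = -J (`Regular.integral_score`, `Regular.integral_scoreJac`): residuals multiplied by
functions of the covariates have conditional mean zero. Finally, a Taylor expansion with J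
invertible forces roots in a fixed small ball to converge to β (`Regular.exists_nhds_consistent`),
and domination of the derivatives lets these roots replace β in the averages
(`WeightedLLN.tendsto_plugIn`).

Convergence in probability is treated as convergence along the filter `probFilter`, so that
products, inverses and other continuous maps are handled by ordinary limit calculus. -/

/-! ### Convergence in probability as convergence along a filter, and second moments of averages. -/

section ProbFilter

variable {Ω : Type*} [MeasurableSpace Ω]

/-- The filter on `ℕ × Ω` of the events whose probability tends to one. Convergence along this
filter is convergence in probability. -/
def probFilter (P : Measure Ω) : Filter (ℕ × Ω) where
  sets := {S | Tendsto (fun n => P {ω | (n, ω) ∉ S}) atTop (𝓝 0)}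
  univ_sets := by simp
  sets_of_superset := by
    intro S T hS hST
    refine tendsto_of_tendsto_of_tendsto_of_le_of_le tendsto_const_nhds hS (fun _ => zero_le) ?_
    exact fun n => measure_mono fun ω hω h => hω (hST h)
  inter_sets := by
    intro S T hS hT
    have h : Tendsto (fun n => P {ω | (n, ω) ∉ S} + P {ω | (n, ω) ∉ T}) atTop (𝓝 0) := by
      simpa using Tendsto.add hS hT
    refine tendsto_of_tendsto_of_tendsto_of_le_of_le tendsto_const_nhds h (fun _ => zero_le) ?_
    intro n
    refine (measure_mono ?_).trans (measure_union_le _ _)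
    intro ω hω
    by_cases h1 : (n, ω) ∈ S
    · exact Or.inr fun h2 => hω ⟨h1, h2⟩
    · exact Or.inl h1

variable {P : Measure Ω}

theorem eventually_probFilter {p : ℕ × Ω → Prop} :
    (∀ᶠ x in probFilter P, p x) ↔ Tendsto (fun n => P {ω | ¬ p (n, ω)}) atTop (𝓝 0) := Iff.rfl

theorem eventually_probFilter_of_ae {p : ℕ × Ω → Prop} (h : ∀ n, ∀ᵐ ω ∂P, p (n, ω)) :
    ∀ᶠ x in probFilter P, p x := by
  rw [eventually_probFilter]
  have : (fun n => P {ω | ¬ p (n, ω)}) = fun _ => 0 := funext fun n => ae_iff.1 (h n)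
  rw [this]
  exact tendsto_const_nhds

/-- Lets deterministic limits, such as that of π_m, and "n large enough" enter arguments along
`probFilter`. -/
theorem tendsto_fst_probFilter : Tendsto Prod.fst (probFilter P) atTop := by
  refine tendsto_atTop.2 fun N => ?_
  rw [eventually_probFilter]
  refine tendsto_const_nhds.congr' ?_
  filter_upwards [eventually_ge_atTop N] with n hn
  simp [hn]

theorem tendstoInMeasure_const_iff {F : ℕ → Ω → ℝ} {c : ℝ} :
    TendstoInMeasure P F atTop (fun _ => c) ↔
      Tendsto (fun x : ℕ × Ω => F x.1 x.2) (probFilter P) (𝓝 c) := by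
  rw [EMetric.tendsto_nhds]
  refine forall₂_congr fun ε _ => ?_
  rw [eventually_probFilter]
  simp only [not_lt]

theorem convergesInProb_iff {ι κ : Type*} {F : ℕ → Ω → Matrix ι κ ℝ} {L : Matrix ι κ ℝ} :
    ConvergesInProb P F L ↔
      Tendsto (fun x : ℕ × Ω => F x.1 x.2) (probFilter P) (𝓝 L) := by
  have h : Tendsto (fun x : ℕ × Ω => F x.1 x.2) (probFilter P) (𝓝 L) ↔
      ∀ i j, Tendsto (fun x : ℕ × Ω => F x.1 x.2 i j) (probFilter P) (𝓝 (L i j)) :=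
    tendsto_pi_nhds.trans (forall_congr' fun i => tendsto_pi_nhds)
  exact (forall₂_congr fun i j => tendstoInMeasure_const_iff).trans h.symm

/-- Markov's inequality: convergence to zero in L¹ implies convergence to zero in probability. -/
theorem tendsto_probFilter_of_integral {f : ℕ → Ω → ℝ} (h0 : ∀ n ω, 0 ≤ f n ω)
    (hint : ∀ n, Integrable (f n) P) (h : Tendsto (fun n => ∫ ω, f n ω ∂P) atTop (𝓝 0)) :
    Tendsto (fun x : ℕ × Ω => f x.1 x.2) (probFilter P) (𝓝 0) := by
  rw [← tendstoInMeasure_const_iff]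
  refine tendstoInMeasure_of_tendsto_eLpNorm one_ne_zero (fun n => (hint n).1)
    aestronglyMeasurable_const ?_
  have h2 : (fun n => eLpNorm (f n - fun _ => 0) 1 P) = fun n => ENNReal.ofReal (∫ ω, f n ω ∂P) := by
    funext n
    rw [eLpNorm_one_eq_lintegral_enorm,
      ofReal_integral_eq_lintegral_ofReal (hint n) (Eventually.of_forall (h0 n))]
    refine lintegral_congr fun ω => ?_
    simp [← ofReal_norm, abs_of_nonneg (h0 n ω)]
  rw [h2]
  simpa using ENNReal.tendsto_ofReal h

/-- Expand the square: orthogonality leaves only the n diagonal terms. It serves both the weighted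
data averages and the arrival indicators. -/
theorem integral_sq_average_le {n : ℕ} {u : Fin n → Ω → ℝ} {C : ℝ}
    (hint : ∀ i j, Integrable (fun ω => u i ω * u j ω) P)
    (h0 : ∀ i j, i ≠ j → ∫ ω, u i ω * u j ω ∂P = 0) (hC : ∀ i, ∫ ω, u i ω * u i ω ∂P ≤ C) :
    Integrable (fun ω => ((1 / (n : ℝ)) * ∑ i, u i ω) ^ 2) P ∧
      ∫ ω, ((1 / (n : ℝ)) * ∑ i, u i ω) ^ 2 ∂P ≤ C / n := by
  have he : (fun ω => ((1 / (n : ℝ)) * ∑ i, u i ω) ^ 2) =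
      fun ω => (1 / (n : ℝ)) ^ 2 * ∑ i, ∑ j, u i ω * u j ω := by
    funext ω
    rw [mul_pow, sq (∑ i, u i ω), Finset.sum_mul_sum]
  have hs : ∀ i, Integrable (fun ω => ∑ j, u i ω * u j ω) P :=
    fun i => integrable_finsetSum _ fun j _ => hint i j
  rw [he]
  refine ⟨(integrable_finsetSum _ fun i _ => hs i).const_mul _, ?_⟩
  rw [integral_const_mul, integral_finsetSum _ fun i _ => hs i]
  have hsum : ∑ i : Fin n, ∫ ω, ∑ j, u i ω * u j ω ∂P ≤ n * C := by
    calc _ ≤ ∑ i : Fin n, C := by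
          refine Finset.sum_le_sum fun i _ => ?_
          rw [integral_finsetSum _ fun j _ => hint i j,
            Finset.sum_eq_single i (fun j _ hj => h0 i j hj.symm) (by simp)]
          exact hC i
      _ = _ := by simp
  rcases Nat.eq_zero_or_pos n with rfl | hn
  · simp
  · have hn' : (0 : ℝ) < n := by exact_mod_cast hn
    calc _ ≤ (1 / (n : ℝ)) ^ 2 * (n * C) := by gcongr
      _ = C / n := by field_simp

end ProbFilter

/-! ### A weak law of large numbers with random weights. -/

section LawOfLargeNumbers

variable {Ω α : Type*} [MeasurableSpace Ω] [MeasurableSpace α] {P : Measure Ω} {M : ℕ}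

theorem integrable_comp_of_map_eq {Q : Measure α} {Z : Ω → α} (hZ : Measurable Z)
    (hlaw : P.map Z = Q) {g : α → ℝ} (hg : Integrable g Q) : Integrable (fun ω => g (Z ω)) P := by
  rw [← hlaw] at hg
  exact hg.comp_measurable hZ

theorem integral_comp_of_map_eq {Q : Measure α} {Z : Ω → α} (hZ : Measurable Z)
    (hlaw : P.map Z = Q) {g : α → ℝ} (hg : AEStronglyMeasurable g Q) :
    ∫ ω, g (Z ω) ∂P = ∫ z, g z ∂Q := by
  subst hlaw
  exact (integral_map hZ.aemeasurable hg).symm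

variable [IsProbabilityMeasure P]

/-- The weights may depend on one another: independence from the data splits each cross moment into
a moment of the weights and a covariance of the data, and the latter vanishes off the diagonal. -/
theorem integral_sq_weighted_average_le {Q : Measure α} {Z : ℕ → Ω → α}
    (hZ : ∀ i, Measurable (Z i)) (hlaw : ∀ i, P.map (Z i) = Q) (hind : iIndepFun Z P)
    {n : ℕ} {A : Fin n → Ω → Fin M} (hA : ∀ i, Measurable (A i))
    (hAZ : IndepFun (fun ω i => A i ω) (fun ω (i : Fin n) => Z i ω) P)
    {φ : Fin M → ℝ} (hφ : ∀ m, |φ m| ≤ 1) {b : α → ℝ} (hb : Measurable b) (hb2 : MemLp b 2 Q) :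
    Integrable (fun ω => ((1 / (n : ℝ)) * ∑ i : Fin n, φ (A i ω) * (b (Z i ω) - ∫ z, b z ∂Q)) ^ 2) P ∧
    ∫ ω, ((1 / (n : ℝ)) * ∑ i : Fin n, φ (A i ω) * (b (Z i ω) - ∫ z, b z ∂Q)) ^ 2 ∂P ≤
      (∫ z, (b z - ∫ z, b z ∂Q) ^ 2 ∂Q) / n := by
  have hQ : IsProbabilityMeasure Q := by
    rw [← hlaw 0]; exact Measure.isProbabilityMeasure_map (hZ 0).aemeasurable
  set c := ∫ z, b z ∂Q with hc
  have hφm : Measurable φ := measurable_of_finite φ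
  have hX2 : MemLp (fun z => b z - c) 2 Q := hb2.sub (memLp_const c)
  have hXi : ∀ i, MemLp (fun ω => b (Z i ω) - c) 2 P := fun i => by
    have := hX2
    rw [← hlaw i] at this
    exact this.comp_of_map (hZ i).aemeasurable
  have hXX : ∀ i j, Integrable (fun ω => (b (Z i ω) - c) * (b (Z j ω) - c)) P :=
    fun i j => (hXi i).integrable_mul (hXi j)
  have hprod : ∀ i j : Fin n, (∫ ω, φ (A i ω) * (b (Z i ω) - c) * (φ (A j ω) * (b (Z j ω) - c)) ∂P)
      = (∫ ω, φ (A i ω) * φ (A j ω) ∂P) * ∫ ω, (b (Z i ω) - c) * (b (Z j ω) - c) ∂P := by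
    intro i j
    have h1 : Measurable fun a : Fin n → Fin M => φ (a i) * φ (a j) := measurable_of_finite _
    have h2 : Measurable fun z : Fin n → α => (b (z i) - c) * (b (z j) - c) := by fun_prop
    have := (hAZ.comp h1 h2).integral_fun_mul_eq_mul_integral
      (h1.comp (measurable_pi_lambda _ hA)).aestronglyMeasurable
      (h2.comp (measurable_pi_lambda _ fun i : Fin n => hZ i)).aestronglyMeasurable
    simp only [Function.comp] at this
    rw [← this]
    exact integral_congr_ae (Eventually.of_forall fun ω => by ring)
  refine integral_sq_average_le ?_ ?_ ?_
  · intro i j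
    refine (hXX i j).mono (by fun_prop) (Eventually.of_forall fun ω => ?_)
    simp only [Real.norm_eq_abs, abs_mul]
    have h1 := hφ (A i ω)
    have h2 := hφ (A j ω)
    calc |φ (A i ω)| * |b (Z i ω) - c| * (|φ (A j ω)| * |b (Z j ω) - c|)
        ≤ 1 * |b (Z i ω) - c| * (1 * |b (Z j ω) - c|) := by gcongr
      _ = _ := by ring
  · intro i j hij
    rw [hprod]
    have hij' : (i : ℕ) ≠ j := fun h => hij (Fin.ext h)
    have h1 : Measurable fun z : α => b z - c := by fun_prop
    have := ((hind.indepFun hij').comp h1 h1).integral_fun_mul_eq_mul_integral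
      (h1.comp (hZ i)).aestronglyMeasurable (h1.comp (hZ j)).aestronglyMeasurable
    simp only [Function.comp] at this
    rw [this, integral_comp_of_map_eq (hZ i) (hlaw i) h1.aestronglyMeasurable,
      integral_sub (hb2.integrable one_le_two) (integrable_const c)]
    simp [hc]
  · intro i
    rw [hprod]
    have h3 : ∫ ω, (b (Z i ω) - c) * (b (Z i ω) - c) ∂P = ∫ z, (b z - c) ^ 2 ∂Q := by
      rw [← integral_comp_of_map_eq (hZ i) (hlaw i) (hX2.integrable_sq).1]
      simp only [sq]
    rw [h3]
    have h4 : ∫ ω, φ (A i ω) * φ (A i ω) ∂P ≤ 1 := by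
      have h5 : ∀ ω, φ (A i ω) * φ (A i ω) ≤ 1 := fun ω => by
        have := hφ (A i ω)
        rw [← sq, ← sq_abs]
        exact pow_le_one₀ (abs_nonneg _) this
      calc _ ≤ ∫ _, (1 : ℝ) ∂P := by
            refine integral_mono_of_nonneg (Eventually.of_forall fun ω => mul_self_nonneg _)
              (integrable_const _) (Eventually.of_forall h5)
        _ = 1 := by simp
    exact mul_le_of_le_one_left (integral_nonneg fun z => sq_nonneg _) h4

/-- Weak law of large numbers for identically distributed variables with bounded random weights
that are independent of the variables. -/
theorem tendsto_weighted_centered_average {Q : Measure α} {Z : ℕ → Ω → α}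
    (hZ : ∀ i, Measurable (Z i)) (hlaw : ∀ i, P.map (Z i) = Q) (hind : iIndepFun Z P)
    {A : (n : ℕ) → Fin n → Ω → Fin M} (hA : ∀ n i, Measurable (A n i))
    (hAZ : ∀ n, IndepFun (fun ω (i : Fin n) => A n i ω) (fun ω (i : Fin n) => Z i ω) P)
    {φ : Fin M → ℝ} (hφ : ∀ m, |φ m| ≤ 1) {g : α → ℝ} (hg : Integrable g Q) :
    Tendsto (fun x : ℕ × Ω => (1 / (x.1 : ℝ)) * ∑ i : Fin x.1,
      φ (A x.1 i x.2) * (g (Z i x.2) - ∫ z, g z ∂Q)) (probFilter P) (𝓝 0) := by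
  have hQ : IsProbabilityMeasure Q := by
    rw [← hlaw 0]; exact Measure.isProbabilityMeasure_map (hZ 0).aemeasurable
  have hφm : Measurable φ := measurable_of_finite φ
  let T : (α → ℝ) → ℕ → Ω → ℝ := fun f n ω =>
    (1 / (n : ℝ)) * ∑ i : Fin n, φ (A n i ω) * (f (Z i ω) - ∫ z, f z ∂Q)
  have hterm : ∀ f, Integrable f Q → ∀ n (i : Fin n),
      Integrable (fun ω => φ (A n i ω) * (f (Z i ω) - ∫ z, f z ∂Q)) P := by
    intro f hf n i
    refine Integrable.bdd_mul (c := 1) ?_ (hφm.comp (hA n i)).aestronglyMeasurable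
      (Eventually.of_forall fun ω => hφ _)
    exact (integrable_comp_of_map_eq (hZ i) (hlaw i) hf).sub (integrable_const _)
  have hTint : ∀ f, Integrable f Q → ∀ n, Integrable (T f n) P := fun f hf n =>
    (integrable_finsetSum _ fun i _ => hterm f hf n i).const_mul _
  -- The factor 2 is E|f - E f| ≤ 2 E|f|; the bound is uniform in n and controls the error of
  -- approximating `g`.
  have hT1 : ∀ f, Integrable f Q → ∀ n, ∫ ω, |T f n ω| ∂P ≤ 2 * ∫ z, |f z| ∂Q := by
    intro f hf n
    have hfi : ∀ i, Integrable (fun ω => |f (Z i ω)| + |∫ z, f z ∂Q|) P := fun i =>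
      (integrable_comp_of_map_eq (hZ i) (hlaw i) hf).abs.add (integrable_const _)
    have hle : ∀ i, ∫ ω, (|f (Z i ω)| + |∫ z, f z ∂Q|) ∂P ≤ 2 * ∫ z, |f z| ∂Q := by
      intro i
      rw [integral_add (integrable_comp_of_map_eq (hZ i) (hlaw i) hf).abs (integrable_const _),
        integral_comp_of_map_eq (g := fun z => |f z|) (hZ i) (hlaw i) hf.abs.1]
      have := abs_integral_le_integral_abs (f := f) (μ := Q)
      simp only [integral_const, probReal_univ, smul_eq_mul, one_mul]
      linarith
    have hb : ∀ ω, |T f n ω| ≤ (1 / (n : ℝ)) * ∑ i : Fin n, (|f (Z i ω)| + |∫ z, f z ∂Q|) := by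
      intro ω
      simp only [T]
      rw [abs_mul, abs_of_nonneg (by positivity)]
      gcongr
      refine (Finset.abs_sum_le_sum_abs _ _).trans (Finset.sum_le_sum fun i _ => ?_)
      rw [abs_mul]
      calc _ ≤ 1 * |f (Z i ω) - ∫ z, f z ∂Q| := by gcongr; exact hφ _
        _ ≤ _ := by rw [one_mul]; exact abs_sub _ _
    calc _ ≤ ∫ ω, (1 / (n : ℝ)) * ∑ i : Fin n, (|f (Z i ω)| + |∫ z, f z ∂Q|) ∂P :=
          integral_mono (hTint f hf n).abs
            ((integrable_finsetSum _ fun i _ => hfi _).const_mul _) hb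
      _ = (1 / (n : ℝ)) * ∑ i : Fin n, ∫ ω, (|f (Z i ω)| + |∫ z, f z ∂Q|) ∂P := by
          rw [integral_const_mul, integral_finsetSum _ fun i _ => hfi _]
      _ ≤ (1 / (n : ℝ)) * ∑ i : Fin n, 2 * ∫ z, |f z| ∂Q := by
          gcongr with i; exact hle i
      _ ≤ 2 * ∫ z, |f z| ∂Q := by
          have h0 : 0 ≤ ∫ z, |f z| ∂Q := integral_nonneg fun _ => abs_nonneg _
          rcases Nat.eq_zero_or_pos n with rfl | hn
          · simpa using h0
          · have hn' : (0 : ℝ) < n := by exact_mod_cast hn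
            simp only [Finset.sum_const, Finset.card_univ, Fintype.card_fin, nsmul_eq_mul]
            apply le_of_eq
            field_simp
  have key : Tendsto (fun n => ∫ ω, |T g n ω| ∂P) atTop (𝓝 0) := by
    rw [Metric.tendsto_atTop]
    intro ε hε
    -- No second moment of `g` is assumed, so it is replaced by a simple function `b`. The remainder
    -- `g - b` costs at most 2 · ε/8 = ε/4, and the variance bound applies to `b`.
    obtain ⟨b, hb, -⟩ := (memLp_one_iff_integrable.2 hg).exists_simpleFunc_eLpNorm_sub_lt
      ENNReal.one_ne_top (ε := ENNReal.ofReal (ε / 8)) (by simp [hε])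
    have hbi : Integrable b Q := SimpleFunc.integrable_of_isFiniteMeasure b
    have hb2 : MemLp b 2 Q := SimpleFunc.memLp_of_isFiniteMeasure b 2 Q
    have hgb : ∫ z, |(g - ⇑b) z| ∂Q < ε / 8 := by
      have h1 := integral_norm_eq_lintegral_enorm (hg.sub hbi).1
      simp only [Real.norm_eq_abs] at h1
      rw [h1, ← eLpNorm_one_eq_lintegral_enorm]
      exact (ENNReal.lt_ofReal_iff_toReal_lt (ne_top_of_lt hb)).1 hb
    set C := ∫ z, (b z - ∫ z, b z ∂Q) ^ 2 ∂Q with hC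
    have hlim : Tendsto (fun n : ℕ => C / n * (4 / ε)) atTop (𝓝 0) := by
      simpa using (tendsto_const_div_atTop_nhds_zero_nat C).mul_const (4 / ε)
    obtain ⟨N, hN⟩ := (hlim.eventually_lt_const (show (0 : ℝ) < ε / 4 by positivity)).exists_forall_of_atTop
    refine ⟨N, fun n hn => ?_⟩
    obtain ⟨hi2, hl2⟩ := integral_sq_weighted_average_le hZ hlaw hind (hA n) (hAZ n) hφ
      b.measurable hb2
    have hpt : ∀ ω, |T g n ω| ≤ T b n ω ^ 2 * (4 / ε) + ε / 4 + |T (g - ⇑b) n ω| := by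
      intro ω
      have h1 : T g n ω = T b n ω + T (g - ⇑b) n ω := by
        simp only [T]
        rw [← mul_add, ← Finset.sum_add_distrib]
        congr 1
        refine Finset.sum_congr rfl fun i _ => ?_
        have : ∫ z, (g - ⇑b) z ∂Q = ∫ z, g z ∂Q - ∫ z, b z ∂Q := integral_sub hg hbi
        rw [this, Pi.sub_apply]
        ring
      have h2 : |T b n ω| ≤ T b n ω ^ 2 * (4 / ε) + ε / 4 := by
        rw [← sq_abs]
        -- Completing the square gives |t| ≤ 4t²/ε + ε/16, which turns the second-moment bound into
        -- a first-moment bound.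
        have : 0 ≤ (|T b n ω| * 2 - ε / 4) ^ 2 * (1 / ε) := by positivity
        have h3 : (|T b n ω| * 2 - ε / 4) ^ 2 * (1 / ε)
            = |T b n ω| ^ 2 * (4 / ε) + ε / 16 - |T b n ω| := by field_simp; ring
        linarith
      rw [h1]
      exact (abs_add_le _ _).trans (by linarith)
    have hi3 : Integrable (fun ω => T b n ω ^ 2 * (4 / ε)) P := hi2.mul_const _
    have hi4 := (hTint _ (hg.sub hbi) n).abs
    have : ∫ ω, |T g n ω| ∂P < ε := by
      calc _ ≤ ∫ ω, (T b n ω ^ 2 * (4 / ε) + ε / 4 + |T (g - ⇑b) n ω|) ∂P :=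
            integral_mono (hTint g hg n).abs ((hi3.add (integrable_const _)).add hi4) hpt
        _ = (∫ ω, T b n ω ^ 2 ∂P) * (4 / ε) + ε / 4 + ∫ ω, |T (g - ⇑b) n ω| ∂P := by
            have h5 : Integrable (fun ω => T b n ω ^ 2 * (4 / ε) + ε / 4) P :=
              hi3.add (integrable_const _)
            rw [integral_add h5 hi4, integral_add hi3 (integrable_const _), integral_mul_const]
            simp
        _ ≤ C / n * (4 / ε) + ε / 4 + 2 * ∫ z, |(g - ⇑b) z| ∂Q := by
            gcongr
            exact hT1 _ (hg.sub hbi) n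
        _ < ε := by linarith [hN n hn]
    rw [Real.dist_eq, sub_zero, abs_of_nonneg (integral_nonneg fun _ => abs_nonneg _)]
    exact this
  have := tendsto_probFilter_of_integral (fun n ω => abs_nonneg (T g n ω))
    (fun n => (hTint g hg n).abs) key
  exact (tendsto_zero_iff_abs_tendsto_zero _).2 this

/-- Split g into g - E g and E g: the centred part averages to zero, and the constant part needs
only the limit of the average weight. -/
theorem tendsto_weighted_average {Q : Measure α} {Z : ℕ → Ω → α}
    (hZ : ∀ i, Measurable (Z i)) (hlaw : ∀ i, P.map (Z i) = Q) (hind : iIndepFun Z P)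
    {A : (n : ℕ) → Fin n → Ω → Fin M} (hA : ∀ n i, Measurable (A n i))
    (hAZ : ∀ n, IndepFun (fun ω (i : Fin n) => A n i ω) (fun ω (i : Fin n) => Z i ω) P)
    {φ : Fin M → ℝ} (hφ : ∀ m, |φ m| ≤ 1) {c : ℝ}
    (hc : Tendsto (fun x : ℕ × Ω => (1 / (x.1 : ℝ)) * ∑ i : Fin x.1, φ (A x.1 i x.2))
      (probFilter P) (𝓝 c))
    {g : α → ℝ} (hg : Integrable g Q) :
    Tendsto (fun x : ℕ × Ω => (1 / (x.1 : ℝ)) * ∑ i : Fin x.1,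
      φ (A x.1 i x.2) * g (Z i x.2)) (probFilter P) (𝓝 (c * ∫ z, g z ∂Q)) := by
  have h := (tendsto_weighted_centered_average hZ hlaw hind hA hAZ hφ hg).add
    (hc.mul_const (∫ z, g z ∂Q))
  rw [zero_add] at h
  refine h.congr fun x => ?_
  simp only [mul_sub, Finset.sum_sub_distrib, ← Finset.sum_mul]
  ring

end LawOfLargeNumbers

/-! ### Nested arrivals and the limiting proportion of arrived groups. -/

section Arrivals

variable {Ω : Type*} {M : ℕ}

theorem sum_arrived (A : (n : ℕ) → Fin n → Ω → Fin M) (n : ℕ) (m : Fin M) (ω : Ω) :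
    ∑ i, arrived A n i m ω = numArrived A n m ω := by
  simp [arrived, numArrived]

/-- A group present at both analyses is one present at the earlier, which is why Λ_{kr} depends on
(k, r) only through min(k, r). -/
theorem arrived_mul_arrived (A : (n : ℕ) → Fin n → Ω → Fin M) (n : ℕ) (i : Fin n) (k r : Fin M)
    (ω : Ω) : arrived A n i k ω * arrived A n i r ω = arrived A n i (min k r) ω := by
  simp only [arrived, le_min_iff]
  split_ifs <;> simp_all

theorem abs_arrived_le_one (A : (n : ℕ) → Fin n → Ω → Fin M) (n : ℕ) (i : Fin n) (m : Fin M)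
    (ω : Ω) : |arrived A n i m ω| ≤ 1 := by
  unfold arrived; split_ifs <;> simp

variable [MeasurableSpace Ω] {P : Measure Ω} [IsProbabilityMeasure P]

theorem measurable_arrived {A : (n : ℕ) → Fin n → Ω → Fin M} (hA : ∀ n i, Measurable (A n i))
    (n : ℕ) (i : Fin n) (m : Fin M) : Measurable (arrived A n i m) :=
  (measurable_of_finite fun a : Fin M => if a ≤ m then (1 : ℝ) else 0).comp (hA n i)

/-- The proportion of groups that have arrived by analysis `m` converges in probability. -/
theorem tendsto_average_arrived {A : (n : ℕ) → Fin n → Ω → Fin M} (hA : ∀ n i, Measurable (A n i))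
    {π : ℕ → Fin M → ℝ} (hπ : ∀ n i m, ∫ ω, arrived A n i m ω ∂P = π n m)
    {ϖ : Fin M → ℝ} (hϖ : ∀ m, Tendsto (fun n => π n m) atTop (𝓝 (ϖ m)))
    (hdich : (∀ n, iIndepFun (A n) P) ∨
      ∃ N : ℕ → Fin M → ℕ, ∀ n m, ∀ᵐ ω ∂P, numArrived A n m ω = N n m) (m : Fin M) :
    Tendsto (fun x : ℕ × Ω => (1 / (x.1 : ℝ)) * ∑ i : Fin x.1, arrived A x.1 i m x.2)
      (probFilter P) (𝓝 (ϖ m)) := by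
  have hπ' : Tendsto (fun x : ℕ × Ω => π x.1 m) (probFilter P) (𝓝 (ϖ m)) :=
    (hϖ m).comp tendsto_fst_probFilter
  have hint : ∀ n (i : Fin n), Integrable (arrived A n i m) P := fun n i =>
    Integrable.of_bound (measurable_arrived hA n i m).aestronglyMeasurable 1
      (Eventually.of_forall fun ω => abs_arrived_le_one A n i m ω)
  rcases hdich with hind | ⟨N, hN⟩
  · let c : Fin M → ℝ := fun a => if a ≤ m then (1 : ℝ) else 0
    have hc : Measurable c := measurable_of_finite c
    have hb : ∀ n : ℕ, Integrable (fun ω => ((1 / (n : ℝ)) *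
          ∑ i : Fin n, (arrived A n i m ω - π n m)) ^ 2) P ∧
        ∫ ω, ((1 / (n : ℝ)) * ∑ i : Fin n, (arrived A n i m ω - π n m)) ^ 2 ∂P ≤ (1 : ℝ) / n := by
      intro n
      have hbd : ∀ i ω, |arrived A n i m ω - π n m| ≤ 1 := by
        intro i ω
        have h1 : ∀ ω, 0 ≤ arrived A n i m ω ∧ arrived A n i m ω ≤ 1 := fun ω => by
          unfold arrived; split_ifs <;> simp
        have h2 : 0 ≤ π n m := hπ n i m ▸ integral_nonneg fun ω => (h1 ω).1
        have h3 : π n m ≤ 1 := by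
          rw [← hπ n i m]
          calc _ ≤ ∫ _, (1 : ℝ) ∂P :=
                integral_mono (hint n i) (integrable_const _) fun ω => (h1 ω).2
            _ = 1 := by simp
        rw [abs_le]
        constructor <;> linarith [(h1 ω).1, (h1 ω).2]
      have hm : ∀ i, Measurable fun ω => arrived A n i m ω - π n m := fun i =>
        (measurable_arrived hA n i m).sub_const _
      have hmulb : ∀ i j ω, |(arrived A n i m ω - π n m) * (arrived A n j m ω - π n m)| ≤ 1 := by
        intro i j ω
        rw [abs_mul]
        exact mul_le_one₀ (hbd i ω) (abs_nonneg _) (hbd j ω)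
      have hint2 : ∀ i j, Integrable
          (fun ω => (arrived A n i m ω - π n m) * (arrived A n j m ω - π n m)) P := fun i j =>
        Integrable.of_bound ((hm i).mul (hm j)).aestronglyMeasurable 1
          (Eventually.of_forall (hmulb i j))
      refine integral_sq_average_le hint2 ?_ ?_
      · intro i j hij
        have := ((hind n).indepFun hij).comp (hc.sub_const (π n m)) (hc.sub_const (π n m))
        have := this.integral_fun_mul_eq_mul_integral (hm i).aestronglyMeasurable
          (hm j).aestronglyMeasurable
        refine this.trans ?_
        have h0 : ∫ ω, (arrived A n i m ω - π n m) ∂P = 0 := by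
          rw [integral_sub (hint n i) (integrable_const _), hπ]; simp
        exact mul_eq_zero_of_left h0 _
      · intro i
        calc _ ≤ ∫ _, (1 : ℝ) ∂P := integral_mono (hint2 i i) (integrable_const _)
              fun ω => (le_abs_self _).trans (hmulb i i ω)
          _ = 1 := by simp
    have h0 := tendsto_probFilter_of_integral (fun n ω => sq_nonneg _) (fun n => (hb n).1)
      (squeeze_zero (fun n => integral_nonneg fun _ => sq_nonneg _) (fun n => (hb n).2)
        tendsto_one_div_atTop_nhds_zero_nat)
    have h1 : Tendsto (fun x : ℕ × Ω => (1 / (x.1 : ℝ)) *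
        ∑ i : Fin x.1, (arrived A x.1 i m x.2 - π x.1 m)) (probFilter P) (𝓝 0) := by
      have := h0.sqrt
      simp only [Real.sqrt_sq_eq_abs, Real.sqrt_zero] at this
      exact (tendsto_zero_iff_abs_tendsto_zero _).2 this
    have h2 := h1.add hπ'
    rw [zero_add] at h2
    refine h2.congr' ?_
    filter_upwards [tendsto_fst_probFilter.eventually (eventually_gt_atTop 0)] with x hx
    have hx' : (0 : ℝ) < x.1 := by exact_mod_cast hx
    rw [Finset.sum_sub_distrib]
    simp only [Finset.sum_const, Finset.card_univ, Fintype.card_fin, nsmul_eq_mul]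
    field_simp
    ring
  -- With almost surely constant counts, taking expectations gives N n m = n π_m, so the proportion
  -- is almost surely π_m itself when n > 0.
  · have hev : ∀ᶠ x : ℕ × Ω in probFilter P, numArrived A x.1 m x.2 = N x.1 m :=
      eventually_probFilter_of_ae fun n => hN n m
    refine hπ'.congr' ?_
    filter_upwards [hev, tendsto_fst_probFilter.eventually (eventually_gt_atTop 0)] with x hx hx0
    have hx' : (0 : ℝ) < x.1 := by exact_mod_cast hx0
    rw [sum_arrived, hx]
    have h1 : ∫ ω, ∑ i, arrived A x.1 i m ω ∂P = N x.1 m := by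
      have : (fun ω => ∑ i, arrived A x.1 i m ω) =ᵐ[P] fun _ => (N x.1 m : ℝ) := by
        filter_upwards [hN x.1 m] with ω hω
        rw [sum_arrived, hω]
      rw [integral_congr_ae this]; simp
    rw [integral_finsetSum _ fun i _ => hint x.1 i] at h1
    simp only [hπ, Finset.sum_const, Finset.card_univ, Fintype.card_fin, nsmul_eq_mul] at h1
    rw [← h1]
    field_simp

end Arrivals

/-! ### Taylor bounds, transfer of conditional expectations, and regularity of derivatives and
matrix inverses. -/

/-- The mean value inequality is used twice: for the derivative, and then for `f` on the closed ball
of radius ‖y - x‖, where the derivative deviates from its value at `x` by at most C‖y - x‖. The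
constant C instead of C/2 is enough. -/
theorem norm_taylor_le {E : Type*} [NormedAddCommGroup E] [NormedSpace ℝ E] {f : E → ℝ} {x : E}
    {ρ C : ℝ} (hf : ∀ y ∈ Metric.ball x ρ, ContDiffAt ℝ 2 f y)
    (hC : ∀ y ∈ Metric.ball x ρ, ‖iteratedFDeriv ℝ 2 f y‖ ≤ C) {y : E}
    (hy : y ∈ Metric.ball x ρ) : ‖f y - f x - fderiv ℝ f x (y - x)‖ ≤ C * ‖y - x‖ ^ 2 := by
  have hρ : 0 < ρ := Metric.pos_of_mem_ball hy
  have hx : x ∈ Metric.ball x ρ := Metric.mem_ball_self hρ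
  have hC0 : 0 ≤ C := (norm_nonneg _).trans (hC x hx)
  have hd : ∀ z ∈ Metric.ball x ρ, DifferentiableAt ℝ (fderiv ℝ f) z := fun z hz =>
    ((hf z hz).fderiv_right (m := 1) (by norm_num)).differentiableAt (by norm_num)
  have hb : ∀ z ∈ Metric.ball x ρ, ‖fderiv ℝ (fderiv ℝ f) z‖ ≤ C := fun z hz => by
    rw [← norm_iteratedFDeriv_one, norm_iteratedFDeriv_fderiv]
    exact hC z hz
  have hg : ∀ z ∈ Metric.ball x ρ, ‖fderiv ℝ f z - fderiv ℝ f x‖ ≤ C * ‖z - x‖ := fun z hz =>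
    (convex_ball x ρ).norm_image_sub_le_of_norm_fderiv_le hd hb hx hz
  set r := ‖y - x‖ with hr
  have hsub : Metric.closedBall x r ⊆ Metric.ball x ρ :=
    Metric.closedBall_subset_ball (by simpa [hr, dist_eq_norm] using hy)
  have h := (convex_closedBall x r).norm_image_sub_le_of_norm_fderiv_le'
    (φ := fderiv ℝ f x) (C := C * r)
    (fun z hz => (hf z (hsub hz)).differentiableAt (by norm_num))
    (fun z hz => (hg z (hsub hz)).trans (by
      have : ‖z - x‖ ≤ r := by simpa [dist_eq_norm] using hz
      gcongr))
    (Metric.mem_closedBall_self (norm_nonneg _)) (show y ∈ Metric.closedBall x r by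
      simp [dist_eq_norm, hr])
  calc _ ≤ C * r * r := h
    _ = C * r ^ 2 := by ring

/-- The first bound serves for evaluating averages at an estimate; the second, with the linear term
kept, serves for consistency. -/
theorem LocallyDominated.exists_taylor {d p : ℕ} {Q : Measure (GroupData d)} {β : Fin p → ℝ}
    {f : (Fin p → ℝ) → GroupData d → ℝ} (hf : LocallyDominated Q β f) :
    ∃ ρ > 0, ∃ H : GroupData d → ℝ, Integrable H Q ∧ (∀ z, 0 ≤ H z) ∧
      ∀ᵐ z ∂Q, ∀ b ∈ Metric.ball β ρ,
        |f b z - f β z| ≤ H z * (‖b - β‖ + ‖b - β‖ ^ 2) ∧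
        |f b z - f β z - fderiv ℝ (fun b => f b z) β (b - β)| ≤ H z * ‖b - β‖ ^ 2 := by
  obtain ⟨-, W, hW, H, hH, hd⟩ := hf
  obtain ⟨ρ, hρ, hρW⟩ := Metric.mem_nhds_iff.1 hW
  refine ⟨ρ, hρ, fun z => |H z|, hH.abs, fun z => abs_nonneg _, ?_⟩
  filter_upwards [hd] with z hz b hb
  have h1 : |f b z - f β z - fderiv ℝ (fun b => f b z) β (b - β)| ≤ |H z| * ‖b - β‖ ^ 2 := by
    refine (norm_taylor_le (f := fun b => f b z) (fun y hy => (hz.2 y (hρW hy)).1)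
      (fun y hy => (hz.2 y (hρW hy)).2) hb).trans ?_
    gcongr
    exact le_abs_self _
  refine ⟨?_, h1⟩
  have h2 : |fderiv ℝ (fun b => f b z) β (b - β)| ≤ |H z| * ‖b - β‖ := by
    refine (ContinuousLinearMap.le_opNorm (fderiv ℝ (fun b => f b z) β) (b - β)).trans ?_
    gcongr
    exact hz.1.trans (le_abs_self _)
  calc |f b z - f β z| = |(f b z - f β z - fderiv ℝ (fun b => f b z) β (b - β))
        + fderiv ℝ (fun b => f b z) β (b - β)| := by ring_nf
    _ ≤ _ := abs_add_le _ _
    _ ≤ _ := by rw [mul_add]; linarith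

theorem fderiv_apply_eq_sum {p : ℕ} (L : (Fin p → ℝ) →L[ℝ] ℝ) (v : Fin p → ℝ) :
    L v = ∑ j, L (Pi.single j 1) * v j := by
  conv_lhs => rw [pi_eq_sum_univ' v]
  simp only [map_sum, map_smul, smul_eq_mul, mul_comm]

theorem measurable_of_sigma {ι : Type*} {α : ι → Type*} [∀ i, MeasurableSpace (α i)] {γ : Type*}
    [MeasurableSpace γ] {f : (Σ i, α i) → γ} (h : ∀ i, Measurable fun x => f ⟨i, x⟩) :
    Measurable f := by
  refine measurable_iff_comap_le.2 ?_
  rintro _ ⟨t, ht, rfl⟩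
  exact MeasurableSpace.measurableSet_iInf.2 fun i => h i ht

/-- All groups thus share one version of the conditional expectation as a function of their data, so
that the law of large numbers applies to it. -/
theorem condExp_comp_of_map_eq {Ω α γ : Type*} [MeasurableSpace Ω] [MeasurableSpace α]
    [MeasurableSpace γ] {P : Measure Ω} [IsFiniteMeasure P] {Q : Measure α} [IsFiniteMeasure Q]
    {Z : Ω → α} (hZ : Measurable Z) (hlaw : P.map Z = Q) {c : α → γ} (hc : Measurable c)
    {f : α → ℝ} (hf : Integrable f Q) :
    P[fun ω => f (Z ω) | MeasurableSpace.comap (fun ω => c (Z ω)) inferInstance] =ᵐ[P]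
      fun ω => (Q[f | MeasurableSpace.comap c inferInstance]) (Z ω) := by
  have hle : MeasurableSpace.comap (fun ω => c (Z ω)) inferInstance ≤ ‹MeasurableSpace Ω› :=
    (hc.comp hZ).comap_le
  have hg : Integrable (Q[f | MeasurableSpace.comap c inferInstance]) Q := integrable_condExp
  symm
  refine ae_eq_condExp_of_forall_setIntegral_eq hle (integrable_comp_of_map_eq hZ hlaw hf) ?_ ?_ ?_
  · exact fun s _ _ => (integrable_comp_of_map_eq hZ hlaw hg).integrableOn
  · rintro _ ⟨t, ht, rfl⟩ _
    have hpre : (fun ω => c (Z ω)) ⁻¹' t = Z ⁻¹' (c ⁻¹' t) := rfl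
    have hmt : MeasurableSet (c ⁻¹' t) := hc ht
    rw [hpre]
    subst hlaw
    rw [← setIntegral_map hmt hg.1 hZ.aemeasurable, ← setIntegral_map hmt hf.1 hZ.aemeasurable]
    exact setIntegral_condExp hc.comap_le hf ⟨t, ht, rfl⟩
  · have h1 : Measurable[MeasurableSpace.comap c inferInstance]
        (Q[f | MeasurableSpace.comap c inferInstance]) := stronglyMeasurable_condExp.measurable
    have h2 : Measurable[MeasurableSpace.comap (fun ω => c (Z ω)) inferInstance,
        MeasurableSpace.comap c inferInstance] Z := by
      rintro _ ⟨t, ht, rfl⟩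
      exact ⟨t, ht, rfl⟩
    exact (h1.comp h2).stronglyMeasurable.aestronglyMeasurable

/-- The directional derivative of `g x` at `b` along the `j`-th axis, as the limit of a sequence
of difference quotients; it is measurable in `x` without any regularity assumption. -/
noncomputable def quotientLimit {X : Type*} {p : ℕ} (g : X → (Fin p → ℝ) → ℝ) (b : Fin p → ℝ)
    (j : Fin p) (x : X) : ℝ :=
  limUnder atTop fun n : ℕ => (n : ℝ) • (g x (b + (n : ℝ)⁻¹ • Pi.single j 1) - g x b)

theorem measurable_quotientLimit {X : Type*} [MeasurableSpace X] {p : ℕ}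
    {g : X → (Fin p → ℝ) → ℝ} (hg : ∀ b, Measurable fun x => g x b) (b : Fin p → ℝ) (j : Fin p) :
    Measurable (quotientLimit g b j) := by
  refine (StronglyMeasurable.limUnder fun n => ?_).measurable
  simp only [smul_eq_mul]
  exact (((hg _).sub (hg b)).const_mul (n : ℝ)).stronglyMeasurable

theorem quotientLimit_eq {X : Type*} {p : ℕ} {g : X → (Fin p → ℝ) → ℝ} {b : Fin p → ℝ} {j : Fin p}
    {x : X} (h : DifferentiableAt ℝ (g x) b) :
    quotientLimit g b j x = fderiv ℝ (g x) b (Pi.single j 1) := by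
  exact ((h.hasFDerivAt.lim_real _).comp tendsto_natCast_atTop_atTop).limUnder_eq

theorem differentiableAt_det {E ι : Type*} [NormedAddCommGroup E] [NormedSpace ℝ E] [Fintype ι]
    [DecidableEq ι] {V : E → Matrix ι ι ℝ} {b : E}
    (hV : ∀ k l, DifferentiableAt ℝ (fun b => V b k l) b) :
    DifferentiableAt ℝ (fun b => (V b).det) b := by
  simp only [Matrix.det_apply]
  refine DifferentiableAt.fun_sum fun σ _ => ?_
  have h : DifferentiableAt ℝ (fun b => ∏ i, V b (σ i) i) b :=
    (HasFDerivAt.finsetProd (u := Finset.univ) fun i _ => (hV (σ i) i).hasFDerivAt).differentiableAt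
  exact h.const_smul (Equiv.Perm.sign σ)

/-- By Cramer's rule the entries of the inverse are quotients of determinants, since those of the
adjugate are determinants with one row made constant. -/
theorem differentiableAt_inv_apply {E ι : Type*} [NormedAddCommGroup E] [NormedSpace ℝ E]
    [Fintype ι] [DecidableEq ι] {V : E → Matrix ι ι ℝ} {b : E}
    (hV : ∀ k l, DifferentiableAt ℝ (fun b => V b k l) b) (hdet : (V b).det ≠ 0) (k l : ι) :
    DifferentiableAt ℝ (fun b => (V b)⁻¹ k l) b := by
  have h : (fun b => (V b)⁻¹ k l) = fun b => ((V b).det)⁻¹ * (V b).adjugate k l := by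
    funext b
    rw [Matrix.inv_def, Matrix.smul_apply, Ring.inverse_eq_inv', smul_eq_mul]
  rw [h]
  refine ((differentiableAt_det hV).fun_inv hdet).fun_mul ?_
  simp only [Matrix.adjugate_apply]
  refine differentiableAt_det fun i j => ?_
  by_cases hi : i = l
  · subst hi; simp
  · simpa [Matrix.updateRow_ne hi] using hV i j

/-- Cramer's rule again; no invertibility is required, since the formula also gives the default
value 0 when the determinant vanishes. -/
theorem measurable_inv_apply {X ι : Type*} [MeasurableSpace X] [Fintype ι] [DecidableEq ι]
    {V : X → Matrix ι ι ℝ} (hV : ∀ k l, Measurable fun x => V x k l) (k l : ι) :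
    Measurable fun x => (V x)⁻¹ k l := by
  have hdet : ∀ {W : X → Matrix ι ι ℝ}, (∀ k l, Measurable fun x => W x k l) →
      Measurable fun x => (W x).det := by
    intro W hW
    simp only [Matrix.det_apply]
    exact Finset.measurable_sum _ fun σ _ =>
      (Finset.measurable_prod _ fun i _ => hW _ _).const_smul (Equiv.Perm.sign σ)
  have h : (fun x => (V x)⁻¹ k l) = fun x => ((V x).det)⁻¹ * (V x).adjugate k l := by
    funext x
    rw [Matrix.inv_def, Matrix.smul_apply, Ring.inverse_eq_inv', smul_eq_mul]
  rw [h]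
  refine (hdet hV).inv.mul ?_
  simp only [Matrix.adjugate_apply]
  refine hdet fun i j => ?_
  by_cases hi : i = l
  · subst hi; simp
  · simpa [Matrix.updateRow_ne hi] using hV i j

/-! ### Moments of the score and of its Jacobian at the true parameter. -/

namespace GEEModel

variable {d p : ℕ} {G : GEEModel d p} {Q : Measure (GroupData d)} {β : Fin p → ℝ}

/-- A linear combination of residuals whose coefficients are functions of the covariates has
conditional expectation zero, without any moment assumption on the single terms. -/
theorem condExp_sum_resid [IsFiniteMeasure Q]
    (hmean : ∀ k : ℕ, Integrable (G.residAt β k) Q ∧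
      Q[G.residAt β k | MeasurableSpace.comap GroupData.cov inferInstance] =ᵐ[Q] 0)
    {c : ℕ → (Σ s : ℕ, (Fin s → Fin d → ℝ)) → ℝ} (hc : ∀ k, Measurable (c k))
    {f : GroupData d → ℝ} (hf : Integrable f Q)
    (hfc : ∀ᵐ z ∂Q, f z = ∑ k ∈ Finset.range z.1, c k z.cov * G.residAt β k z) :
    Q[f | MeasurableSpace.comap GroupData.cov inferInstance] =ᵐ[Q] 0 := by
  have hle : MeasurableSpace.comap (GroupData.cov (d := d)) inferInstance ≤
      (inferInstance : MeasurableSpace (GroupData d)) := GroupData.measurable_cov.comap_le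
  -- Coefficients beyond the group size are irrelevant and are set to zero; this ensures that the
  -- sets `S K` exhaust the space.
  let e : ℕ → (Σ s : ℕ, (Fin s → Fin d → ℝ)) → ℝ := fun k x => if k < x.1 then c k x else 0
  let S : ℕ → Set (GroupData d) := fun K =>
    GroupData.cov ⁻¹' {x | x.1 ≤ K ∧ ∀ k ∈ Finset.range K, |e k x| ≤ K}
  have hfst : Measurable fun x : Σ s : ℕ, (Fin s → Fin d → ℝ) => x.1 :=
    measurable_of_sigma fun s => measurable_const
  have he : ∀ k, Measurable (e k) := fun k =>
    Measurable.ite (measurableSet_lt measurable_const hfst) (hc k) measurable_const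
  have hS : ∀ K, MeasurableSet[MeasurableSpace.comap GroupData.cov inferInstance] (S K) := by
    intro K
    refine ⟨_, ?_, rfl⟩
    refine (measurableSet_le hfst measurable_const).inter ?_
    have : {x : Σ s : ℕ, (Fin s → Fin d → ℝ) | ∀ k ∈ Finset.range K, |e k x| ≤ K} =
        ⋂ k ∈ Finset.range K, {x | |e k x| ≤ K} := by ext; simp
    change MeasurableSet {x : Σ s : ℕ, (Fin s → Fin d → ℝ) | ∀ k ∈ Finset.range K, |e k x| ≤ K}
    rw [this]
    exact Finset.measurableSet_biInter _ fun k _ => measurableSet_le (he k).abs measurable_const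
  have hcm : ∀ k, Measurable[MeasurableSpace.comap GroupData.cov inferInstance]
      fun z : GroupData d => e k z.cov := fun k => (he k).comp (comap_measurable _)
  -- On `S K`, an event of the covariates, the sum has at most `K` terms and bounded coefficients,
  -- so each coefficient can be pulled out of the conditional expectation.
  have hK : ∀ K, (S K).indicator (Q[f | MeasurableSpace.comap GroupData.cov inferInstance])
      =ᵐ[Q] 0 := by
    intro K
    let g : ℕ → GroupData d → ℝ := fun k => (S K).indicator fun z => e k z.cov
    have hgm : ∀ k, StronglyMeasurable[MeasurableSpace.comap GroupData.cov inferInstance] (g k) :=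
      fun k => ((hcm k).indicator (hS K)).stronglyMeasurable
    have hgb : ∀ k ∈ Finset.range K, ∀ z, ‖g k z‖ ≤ K := by
      intro k hk z
      by_cases hz : z ∈ S K
      · simpa [g, hz] using hz.2 k hk
      · simp [g, hz]
    have hi : ∀ k ∈ Finset.range K, Integrable (g k * G.residAt β k) Q := fun k hk =>
      (hmean k).1.bdd_mul ((hgm k).mono hle).aestronglyMeasurable
        (Eventually.of_forall (hgb k hk))
    have h1 : (S K).indicator f =ᵐ[Q] ∑ k ∈ Finset.range K, g k * G.residAt β k := by
      filter_upwards [hfc] with z hz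
      rw [Finset.sum_apply]
      by_cases hzS : z ∈ S K
      · rw [Set.indicator_of_mem hzS, hz]
        refine (Finset.sum_subset (Finset.range_mono hzS.1) ?_).trans
          (Finset.sum_congr rfl fun k _ => ?_)
        · intro k _ hk
          have : ¬ k < z.1 := fun h => hk (Finset.mem_range.2 h)
          simp [residAt, this]
        · by_cases hk : k < z.1
          · have : k < z.cov.1 := hk
            simp [g, hzS, e, this]
          · simp [residAt, hk]
      · simp [g, hzS]
    have h2 : ∀ k ∈ Finset.range K, Q[g k * G.residAt β k |
        MeasurableSpace.comap GroupData.cov inferInstance] =ᵐ[Q] 0 := by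
      intro k hk
      refine (condExp_stronglyMeasurable_mul_of_bound hle (hgm k) (hmean k).1 K
        (Eventually.of_forall (hgb k hk))).trans ?_
      filter_upwards [(hmean k).2] with z hz
      simp [hz]
    refine (condExp_indicator hf (hS K)).symm.trans ((condExp_congr_ae h1).trans
      ((condExp_finsetSum hi _).trans ?_))
    filter_upwards [(Finset.eventually_all _).2 h2] with z hz
    rw [Finset.sum_apply]
    exact Finset.sum_eq_zero hz
  filter_upwards [ae_all_iff.2 hK] with z hz
  -- Such a `K` exceeds both the group size and every coefficient in use, so each group lies in some
  -- `S K`.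
  obtain ⟨K, hK1⟩ := exists_nat_ge ((z.1 : ℝ) + ∑ k ∈ Finset.range z.1, |c k z.cov|)
  have hsum : 0 ≤ ∑ k ∈ Finset.range z.1, |c k z.cov| := Finset.sum_nonneg fun _ _ => abs_nonneg _
  have hmem : z ∈ S K := by
    refine ⟨?_, fun k _ => ?_⟩
    · have : (z.1 : ℝ) ≤ K := by linarith
      exact_mod_cast this
    · by_cases hk : k < z.cov.1
      · have h1 : |c k z.cov| ≤ ∑ k ∈ Finset.range z.1, |c k z.cov| :=
          Finset.single_le_sum (f := fun k => |c k z.cov|) (fun _ _ => abs_nonneg _)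
            (Finset.mem_range.2 hk)
        have h2 : (0 : ℝ) ≤ z.1 := Nat.cast_nonneg _
        simp only [e, hk, if_true]
        linarith
      · simp [e, hk]
  have := hz K
  rwa [Set.indicator_of_mem hmem] at this

theorem integral_sum_resid [IsFiniteMeasure Q]
    (hmean : ∀ k : ℕ, Integrable (G.residAt β k) Q ∧
      Q[G.residAt β k | MeasurableSpace.comap GroupData.cov inferInstance] =ᵐ[Q] 0)
    {c : ℕ → (Σ s : ℕ, (Fin s → Fin d → ℝ)) → ℝ} (hc : ∀ k, Measurable (c k))
    {f : GroupData d → ℝ} (hf : Integrable f Q)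
    (hfc : ∀ᵐ z ∂Q, f z = ∑ k ∈ Finset.range z.1, c k z.cov * G.residAt β k z) :
    ∫ z, f z ∂Q = 0 := by
  rw [← integral_condExp GroupData.measurable_cov.comap_le,
    integral_congr_ae (condExp_sum_resid hmean hc hf hfc)]
  simp

/-- The weight of the `k`-th residual in the `a`-th component of the score, with the derivative of
the mean replaced by the limit of its difference quotients. -/
noncomputable def weight (G : GEEModel d p) (s : ℕ) (a : Fin p) (k : Fin s)
    (x : Fin s → Fin d → ℝ) (b : Fin p → ℝ) : ℝ :=
  ∑ l, quotientLimit G.mean b a (x l) * (G.V s x b)⁻¹ l k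

/-- Extension of a family of functions of the covariates by zero to all indices. -/
noncomputable def extendCov (w : (s : ℕ) → Fin s → (Fin s → Fin d → ℝ) → ℝ) (k : ℕ)
    (x : Σ s : ℕ, (Fin s → Fin d → ℝ)) : ℝ :=
  if h : k < x.1 then w x.1 ⟨k, h⟩ x.2 else 0

theorem measurable_extendCov {w : (s : ℕ) → Fin s → (Fin s → Fin d → ℝ) → ℝ}
    (hw : ∀ s k, Measurable (w s k)) (k : ℕ) : Measurable (extendCov w k) := by
  refine measurable_of_sigma fun s => ?_
  by_cases h : k < s
  · simpa [extendCov, h] using hw s ⟨k, h⟩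
  · simp [extendCov, h]

theorem sum_extendCov_mul_residAt (w : (s : ℕ) → Fin s → (Fin s → Fin d → ℝ) → ℝ)
    (z : GroupData d) :
    ∑ k ∈ Finset.range z.1, extendCov w k z.cov * G.residAt β k z =
      ∑ k, w z.1 k z.2.1 * G.resid β z k := by
  rw [Finset.sum_range]
  refine Finset.sum_congr rfl fun k _ => ?_
  have : (k : ℕ) < z.cov.1 := k.2
  simp only [extendCov, residAt, k.2, this, dif_pos]
  rfl

theorem Regular.measurable_weight (hG : G.Regular Q β) (s : ℕ) (a : Fin p) (k : Fin s)
    (b : Fin p → ℝ) : Measurable fun x => G.weight s a k x b :=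
  Finset.measurable_sum _ fun l _ =>
    ((measurable_quotientLimit hG.measurable_mean b a).comp (measurable_pi_apply l)).mul
      (measurable_inv_apply (hG.measurable_V s b) l k)

theorem weight_eq {b : Fin p → ℝ} {z : GroupData d}
    (h : ∀ k, DifferentiableAt ℝ (G.mean (z.2.1 k)) b) (a : Fin p) (k : Fin z.1) :
    G.weight z.1 a k z.2.1 b = ((G.D b z)ᵀ * (G.V z.1 z.2.1 b)⁻¹) a k := by
  rw [Matrix.mul_apply]
  refine Finset.sum_congr rfl fun l _ => ?_
  rw [quotientLimit_eq (h l)]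
  rfl

theorem score_eq_sum_weight {b : Fin p → ℝ} {z : GroupData d}
    (h : ∀ k, DifferentiableAt ℝ (G.mean (z.2.1 k)) b) (a : Fin p) :
    G.score b z a = ∑ k, G.weight z.1 a k z.2.1 b * G.resid b z k := by
  simp only [weight_eq h]
  rfl

theorem Regular.integral_score [IsFiniteMeasure Q] (hG : G.Regular Q β) (a : Fin p) :
    ∫ z, G.score β z a ∂Q = 0 := by
  refine integral_sum_resid hG.mean_correct
    (c := extendCov fun s k x => G.weight s a k x β)
    (measurable_extendCov fun s k => hG.measurable_weight s a k β) (hG.score_dom a).1 ?_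
  obtain ⟨W, hW, h⟩ := hG.smooth
  filter_upwards [h] with z hz
  rw [sum_extendCov_mul_residAt]
  exact score_eq_sum_weight
    (fun k => ((hz β (mem_of_mem_nhds hW)).1 k).differentiableAt (by norm_num)) a

/-- Product rule: differentiating DᵀV⁻¹ leaves a combination of residuals with coefficients
depending only on the covariates, and differentiating the residual gives -DᵀV⁻¹D. -/
theorem scoreJac_eq {z : GroupData d} {W : Set (Fin p → ℝ)} (hW : W ∈ 𝓝 β)
    (hz : ∀ b ∈ W, (∀ k, ContDiffAt ℝ 2 (G.mean (z.2.1 k)) b) ∧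
      (∀ k l, ContDiffAt ℝ 1 (fun b' => G.V z.1 z.2.1 b' k l) b) ∧ (G.V z.1 z.2.1 b).PosDef)
    (a j : Fin p) :
    G.scoreJac β z a j =
      ∑ k, quotientLimit (G.weight z.1 a k) β j z.2.1 * G.resid β z k - G.info β z a j := by
  have hmd : ∀ b ∈ W, ∀ k, DifferentiableAt ℝ (G.mean (z.2.1 k)) b := fun b hb k =>
    ((hz b hb).1 k).differentiableAt (by norm_num)
  have hβ := mem_of_mem_nhds hW
  obtain ⟨h1, h2, h3⟩ := hz β hβ
  have hw : ∀ k, DifferentiableAt ℝ (G.weight z.1 a k z.2.1) β := by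
    intro k
    have he : G.weight z.1 a k z.2.1 =ᶠ[𝓝 β] fun b => ∑ l,
        fderiv ℝ (G.mean (z.2.1 l)) b (Pi.single a 1) * (G.V z.1 z.2.1 b)⁻¹ l k := by
      filter_upwards [hW] with b hb
      exact Finset.sum_congr rfl fun l _ => by rw [quotientLimit_eq (hmd b hb l)]
    refine DifferentiableAt.congr_of_eventuallyEq ?_ he
    refine DifferentiableAt.fun_sum fun l _ => DifferentiableAt.fun_mul ?_ ?_
    · exact (((h1 l).fderiv_right (m := 1) (by norm_num)).differentiableAt
        (by norm_num)).clm_apply (differentiableAt_const _)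
    · exact differentiableAt_inv_apply (fun k l => (h2 k l).differentiableAt (by norm_num))
        h3.det_pos.ne' l k
  have hs : (fun b => G.score b z a) =ᶠ[𝓝 β]
      fun b => ∑ k, G.weight z.1 a k z.2.1 b * G.resid b z k := by
    filter_upwards [hW] with b hb
    exact score_eq_sum_weight (hmd b hb) a
  have hr : ∀ k, HasFDerivAt (fun b => G.resid b z k) (-fderiv ℝ (G.mean (z.2.1 k)) β) β :=
    fun k => (hmd β hβ k).hasFDerivAt.const_sub _
  have hd := HasFDerivAt.fun_sum (u := Finset.univ) fun k _ => (hw k).hasFDerivAt.fun_mul (hr k)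
  have hj : G.scoreJac β z a j = fderiv ℝ (fun b => G.score b z a) β (Pi.single j 1) := rfl
  have hi : G.info β z a j =
      ∑ k, G.weight z.1 a k z.2.1 β * fderiv ℝ (G.mean (z.2.1 k)) β (Pi.single j 1) := by
    simp only [weight_eq (hmd β hβ)]
    rfl
  rw [hj, hs.fderiv_eq, hd.fderiv, hi, ← Finset.sum_sub_distrib]
  simp only [_root_.sum_apply]
  refine Finset.sum_congr rfl fun k _ => ?_
  rw [quotientLimit_eq (hw k)]
  simp
  ring

theorem measurable_resid_sum (hG : G.Regular Q β)
    {w : (s : ℕ) → Fin s → (Fin s → Fin d → ℝ) → ℝ} (hw : ∀ s k, Measurable (w s k)) :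
    Measurable fun z : GroupData d => ∑ k, w z.1 k z.2.1 * G.resid β z k := by
  refine measurable_of_sigma fun s => ?_
  have hr : ∀ k, Measurable fun x : (Fin s → Fin d → ℝ) × (Fin s → ℝ) =>
      x.2 k - G.mean (x.1 k) β := fun k =>
    ((measurable_pi_apply k).comp measurable_snd).sub
      ((hG.measurable_mean β).comp ((measurable_pi_apply k).comp measurable_fst))
  have h : ∀ k, Measurable fun x : (Fin s → Fin d → ℝ) × (Fin s → ℝ) =>
      w s k x.1 * (x.2 k - G.mean (x.1 k) β) := fun k =>
    ((hw s k).comp measurable_fst).mul (hr k)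
  exact Finset.measurable_sum Finset.univ fun k _ => h k

/-- At the true parameter, the expected Jacobian of the score is minus the expected information. -/
theorem Regular.integral_scoreJac [IsFiniteMeasure Q] (hG : G.Regular Q β) (a j : Fin p) :
    Integrable (fun z => G.scoreJac β z a j) Q ∧
      ∫ z, G.scoreJac β z a j ∂Q = -∫ z, G.info β z a j ∂Q := by
  obtain ⟨W, hW, h⟩ := hG.smooth
  let w : (s : ℕ) → Fin s → (Fin s → Fin d → ℝ) → ℝ := fun s k =>
    quotientLimit (G.weight s a k) β j
  have hw : ∀ s k, Measurable (w s k) := fun s k =>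
    measurable_quotientLimit (hG.measurable_weight s a k) β j
  let R : GroupData d → ℝ := fun z => ∑ k, w z.1 k z.2.1 * G.resid β z k
  have heq : (fun z => G.scoreJac β z a j) =ᵐ[Q] fun z => R z - G.info β z a j := by
    filter_upwards [h] with z hz
    exact scoreJac_eq hW hz a j
  have hinfo : Integrable (fun z => G.info β z a j) Q := (hG.info_dom a j).1
  have hRm : Measurable R := measurable_resid_sum hG hw
  -- The Jacobian is integrable by the bound on the gradient, and `R` then by the identity `heq`;
  -- the single terms of `R` need not be integrable.
  have hJ : Integrable (fun z => G.scoreJac β z a j) Q := by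
    obtain ⟨-, _, _, H, hH, hd⟩ := hG.score_dom a
    refine (hH.abs.mul_const ‖(Pi.single j 1 : Fin p → ℝ)‖).mono'
      ((hRm.aestronglyMeasurable.sub hinfo.1).congr heq.symm) ?_
    filter_upwards [hd] with z hz
    refine (ContinuousLinearMap.le_opNorm (fderiv ℝ (fun b => G.score b z a) β) _).trans ?_
    gcongr
    exact hz.1.trans (le_abs_self _)
  have hR : Integrable R Q := by
    refine (hJ.add hinfo).congr ?_
    filter_upwards [heq] with z hz
    simp only [Pi.add_apply] at hz ⊢
    linarith
  have hR0 : ∫ z, R z ∂Q = 0 := integral_sum_resid hG.mean_correct (measurable_extendCov hw) hR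
    (Eventually.of_forall fun z => (sum_extendCov_mul_residAt w z).symm)
  refine ⟨hJ, ?_⟩
  rw [integral_congr_ae heq, integral_sub hR hinfo, hR0, zero_sub]

/-- Symmetry of V⁻¹ makes the right factor the transpose of the left one, so the product is ψψᵀ. -/
theorem Regular.meat_eq (hG : G.Regular Q β) (a j : Fin p) :
    (fun z => G.meat β z a j) =ᵐ[Q] fun z => G.score β z a * G.score β z j := by
  obtain ⟨W, hW, h⟩ := hG.smooth
  filter_upwards [h] with z hz
  have hsymm : ((G.V z.1 z.2.1 β)⁻¹)ᵀ = (G.V z.1 z.2.1 β)⁻¹ := by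
    have := (hz β (mem_of_mem_nhds hW)).2.2.isHermitian.inv
    rwa [IsHermitian, conjTranspose_eq_transpose_of_trivial] at this
  have h1 : G.meat β z = vecMulVec (G.score β z) (G.score β z) := by
    unfold meat score
    rw [Matrix.mul_vecMulVec, Matrix.vecMulVec_mul, Matrix.vecMulVec_mul, Matrix.vecMul_vecMul]
    congr 1
    rw [← Matrix.vecMul_transpose, Matrix.transpose_mul, Matrix.transpose_transpose, hsymm]
  rw [h1]
  rfl

end GEEModel

/-! ### Algebra of weighted averages. -/

section WeightedAverage

variable {Ω α : Type*}

/-- The average `(1/n) ∑ w_i g(Z_i)` over the first `n` groups, as a function on `ℕ × Ω`. -/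
noncomputable def weightedAverage (w : (n : ℕ) → Fin n → Ω → ℝ) (Z : ℕ → Ω → α) (g : α → ℝ)
    (x : ℕ × Ω) : ℝ :=
  (1 / (x.1 : ℝ)) * ∑ i : Fin x.1, w x.1 i x.2 * g (Z i x.2)

/-- Weighted averages of integrable functions of the groups obey the weak law of large numbers,
with asymptotic weight `c`. -/
def WeightedLLN [MeasurableSpace Ω] [MeasurableSpace α] (P : Measure Ω) (Q : Measure α)
    (w : (n : ℕ) → Fin n → Ω → ℝ) (Z : ℕ → Ω → α) (c : ℝ) : Prop :=
  ∀ g : α → ℝ, Integrable g Q →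
    Tendsto (weightedAverage w Z g) (probFilter P) (𝓝 (c * ∫ z, g z ∂Q))

variable {w : (n : ℕ) → Fin n → Ω → ℝ} {Z : ℕ → Ω → α}

theorem abs_weightedAverage_le {x : ℕ × Ω} (hw : ∀ n i ω, 0 ≤ w n i ω) {g h : α → ℝ}
    (hgh : ∀ i, |g (Z i x.2)| ≤ h (Z i x.2)) :
    |weightedAverage w Z g x| ≤ weightedAverage w Z h x := by
  unfold weightedAverage
  rw [abs_mul, abs_of_nonneg (by positivity)]
  gcongr
  refine (Finset.abs_sum_le_sum_abs _ _).trans (Finset.sum_le_sum fun i _ => ?_)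
  rw [abs_mul, abs_of_nonneg (hw _ _ _)]
  exact mul_le_mul_of_nonneg_left (hgh i) (hw _ _ _)

theorem weightedAverage_sub (g h : α → ℝ) (x : ℕ × Ω) :
    weightedAverage w Z (fun z => g z - h z) x =
      weightedAverage w Z g x - weightedAverage w Z h x := by
  simp only [weightedAverage, mul_sub, Finset.sum_sub_distrib]

theorem weightedAverage_mul_const (g : α → ℝ) (t : ℝ) (x : ℕ × Ω) :
    weightedAverage w Z (fun z => g z * t) x = weightedAverage w Z g x * t := by
  simp only [weightedAverage, ← mul_assoc, ← Finset.sum_mul]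

theorem weightedAverage_sum {ι : Type*} (s : Finset ι) (g : ι → α → ℝ) (x : ℕ × Ω) :
    weightedAverage w Z (fun z => ∑ j ∈ s, g j z) x = ∑ j ∈ s, weightedAverage w Z (g j) x := by
  simp only [weightedAverage, Finset.mul_sum]
  rw [Finset.sum_comm]

theorem eventually_forall_of_ae [MeasurableSpace Ω] [MeasurableSpace α] {P : Measure Ω}
    {Q : Measure α} (hZ : ∀ i, Measurable (Z i)) (hlaw : ∀ i, P.map (Z i) = Q) {q : α → Prop}
    (hq : ∀ᵐ z ∂Q, q z) : ∀ᶠ x in probFilter P, ∀ i, q (Z i x.2) := by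
  refine eventually_probFilter_of_ae fun n => ae_all_iff.2 fun i => ?_
  rw [← hlaw i] at hq
  exact ae_of_ae_map (hZ i).aemeasurable hq

end WeightedAverage

/-! ### Averages at estimated parameters, and consistency of the roots. -/

section PlugIn

variable {Ω : Type*} [MeasurableSpace Ω] {P : Measure Ω} {d p : ℕ} {Q : Measure (GroupData d)}
  {Z : ℕ → Ω → GroupData d} {w : (n : ℕ) → Fin n → Ω → ℝ} {c : ℝ} {β : Fin p → ℝ}

/-- Averages of a locally dominated function may be evaluated at a consistent estimate. -/
theorem WeightedLLN.tendsto_plugIn (hLLN : WeightedLLN P Q w Z c)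
    (hZ : ∀ i, Measurable (Z i)) (hlaw : ∀ i, P.map (Z i) = Q) (hw : ∀ n i ω, 0 ≤ w n i ω)
    {f : (Fin p → ℝ) → GroupData d → ℝ} (hf : LocallyDominated Q β f)
    {b : ℕ × Ω → Fin p → ℝ} (hb : Tendsto b (probFilter P) (𝓝 β)) :
    Tendsto (fun x => weightedAverage w Z (f (b x)) x) (probFilter P)
      (𝓝 (c * ∫ z, f β z ∂Q)) := by
  obtain ⟨ρ, hρ, H, hH, -, hT⟩ := hf.exists_taylor
  have hn : Tendsto (fun x => ‖b x - β‖) (probFilter P) (𝓝 0) :=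
    tendsto_iff_norm_sub_tendsto_zero.1 hb
  -- The average of `H` converges, hence stays bounded in probability, while the other factor
  -- vanishes.
  have hlim : Tendsto (fun x => weightedAverage w Z H x * (‖b x - β‖ + ‖b x - β‖ ^ 2))
      (probFilter P) (𝓝 0) := by
    simpa using (hLLN H hH).mul (hn.add (hn.pow 2))
  have hdiff : Tendsto (fun x => weightedAverage w Z (f (b x)) x - weightedAverage w Z (f β) x)
      (probFilter P) (𝓝 0) := by
    refine squeeze_zero_norm' ?_ hlim
    filter_upwards [eventually_forall_of_ae hZ hlaw hT, hb.eventually (Metric.ball_mem_nhds β hρ)]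
      with x hx hbx
    rw [← weightedAverage_sub, ← weightedAverage_mul_const]
    exact abs_weightedAverage_le hw fun i => (hx i (b x) hbx).1
  simpa using hdiff.add (hLLN (f β) hf.1)

theorem exists_common_taylor {ι : Type*} [Finite ι] {f : ι → (Fin p → ℝ) → GroupData d → ℝ}
    (hf : ∀ a, LocallyDominated Q β (f a)) :
    ∃ ρ > 0, ∃ H : GroupData d → ℝ, Integrable H Q ∧ (∀ z, 0 ≤ H z) ∧
      ∀ᵐ z ∂Q, ∀ b ∈ Metric.ball β ρ, ∀ a,
        |f a b z - f a β z - fderiv ℝ (fun b => f a b z) β (b - β)| ≤ H z * ‖b - β‖ ^ 2 := by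
  cases nonempty_fintype ι
  choose ρ hρ H hH hH0 hT using fun a => (hf a).exists_taylor
  have hev : ∀ᶠ r in 𝓝[>] (0 : ℝ), ∀ a, r ≤ ρ a := eventually_all.2 fun a =>
    eventually_nhdsWithin_of_eventually_nhds (eventually_le_nhds (hρ a))
  obtain ⟨r, hr, hr0⟩ := (hev.and self_mem_nhdsWithin).exists
  refine ⟨r, hr0, fun z => ∑ a, H a z, integrable_finsetSum _ fun a _ => hH a,
    fun z => Finset.sum_nonneg fun a _ => hH0 a z, ?_⟩
  filter_upwards [ae_all_iff.2 hT] with z hz b hb a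
  refine (hz a b (Metric.ball_subset_ball (hr a) hb)).2.trans ?_
  gcongr
  exact Finset.single_le_sum (f := fun a => H a z) (fun a _ => hH0 a z) (Finset.mem_univ a)

theorem exists_norm_le_mulVec {J : Matrix (Fin p) (Fin p) ℝ} (hJ : IsUnit J.det) :
    ∃ κ > 0, ∀ v, ‖v‖ ≤ κ * ‖J *ᵥ v‖ := by
  let L := (Matrix.mulVecLin J⁻¹).toContinuousLinearMap
  refine ⟨‖L‖ + 1, by positivity, fun v => ?_⟩
  have h : L (J *ᵥ v) = v := by
    simp [L, Matrix.mulVec_mulVec, Matrix.nonsing_inv_mul _ hJ]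
  calc ‖v‖ = ‖L (J *ᵥ v)‖ := by rw [h]
    _ ≤ ‖L‖ * ‖J *ᵥ v‖ := L.le_opNorm _
    _ ≤ _ := by gcongr; linarith

/-- Solutions of the weighted estimating equations that stay in a fixed small neighbourhood of the
true parameter are consistent. -/
theorem GEEModel.Regular.exists_nhds_consistent [IsFiniteMeasure Q] {G : GEEModel d p}
    (hG : G.Regular Q β) (hLLN : WeightedLLN P Q w Z c) (hc : 0 < c)
    (hZ : ∀ i, Measurable (Z i)) (hlaw : ∀ i, P.map (Z i) = Q) (hw : ∀ n i ω, 0 ≤ w n i ω) :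
    ∃ U ∈ 𝓝 β, ∀ b : ℕ × Ω → Fin p → ℝ,
      (∀ᶠ x in probFilter P, ∀ a, weightedAverage w Z (fun z => G.score (b x) z a) x = 0) →
      (∀ᶠ x in probFilter P, b x ∈ U) → Tendsto b (probFilter P) (𝓝 β) := by
  set J : Matrix (Fin p) (Fin p) ℝ := Matrix.of fun a j => ∫ z, G.info β z a j ∂Q with hJdef
  obtain ⟨κ, hκ, hκJ⟩ := exists_norm_le_mulVec hG.nonsingular
  obtain ⟨ρ, hρ, H, hH, hH0, hT⟩ := exists_common_taylor hG.score_dom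
  set h := c * ∫ z, H z ∂Q with hh
  have hh0 : 0 ≤ h := mul_nonneg hc.le (integral_nonneg hH0)
  -- The average of `H` is below h + 1 with probability tending to one; the radius makes κ(h + 1)‖v‖
  -- at most c/4, so the quadratic remainder costs at most c/4 · ‖v‖.
  set r := min ρ (c / (4 * κ * (h + 1))) with hr
  have hr0 : 0 < r := lt_min hρ (by positivity)
  refine ⟨Metric.ball β r, Metric.ball_mem_nhds β hr0, fun b hsol hbU => ?_⟩
  let S : Fin p → ℕ × Ω → ℝ := fun a => weightedAverage w Z fun z => G.score β z a
  let T : Fin p → Fin p → ℕ × Ω → ℝ := fun a j =>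
    weightedAverage w Z fun z => G.scoreJac β z a j
  have hS : Tendsto (fun x => ∑ a, |S a x|) (probFilter P) (𝓝 0) := by
    have : ∀ a, Tendsto (fun x => |S a x|) (probFilter P) (𝓝 0) := fun a => by
      have := (hLLN _ (hG.score_dom a).1).abs
      rwa [hG.integral_score, mul_zero, abs_zero] at this
    simpa using tendsto_finsetSum Finset.univ fun a _ => this a
  have hE : Tendsto (fun x => κ * ∑ a, ∑ j, |T a j x + c * J a j|) (probFilter P) (𝓝 0) := by
    have : ∀ a j, Tendsto (fun x => |T a j x + c * J a j|) (probFilter P) (𝓝 0) := fun a j => by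
      have := ((hLLN _ (hG.integral_scoreJac a j).1).add_const (c * J a j)).abs
      rw [(hG.integral_scoreJac a j).2] at this
      simpa [hJdef] using this
    simpa using (tendsto_finsetSum Finset.univ fun a _ =>
      tendsto_finsetSum Finset.univ fun j _ => this a j).const_mul κ
  have hHlim : ∀ᶠ x in probFilter P, weightedAverage w Z H x < h + 1 :=
    (hLLN H hH).eventually_lt_const (by linarith)
  have hElim : ∀ᶠ x in probFilter P, κ * ∑ a, ∑ j, |T a j x + c * J a j| < c / 4 :=
    hE.eventually_lt_const (by positivity)
  rw [tendsto_iff_norm_sub_tendsto_zero]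
  have hlim : Tendsto (fun x => (2 * κ / c) * ∑ a, |S a x|) (probFilter P) (𝓝 0) := by
    simpa using hS.const_mul (2 * κ / c)
  refine squeeze_zero' (Eventually.of_forall fun x => norm_nonneg _) ?_ hlim
  filter_upwards [hsol, hbU, hHlim, hElim, eventually_forall_of_ae hZ hlaw hT]
    with x hx0 hxU hxH hxE hxT
  set v := b x - β with hv
  set s := ∑ a, |S a x| with hs
  set e := ∑ a, ∑ j, |T a j x + c * J a j| with he
  have hvr : ‖v‖ < r := by simpa [hv, dist_eq_norm] using hxU
  have hHx : 0 ≤ weightedAverage w Z H x :=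
    (abs_nonneg _).trans (abs_weightedAverage_le hw fun i => (abs_of_nonneg (hH0 _)).le)
  -- Average the Taylor bound over the groups; the score average at `b x` vanishes by the estimating
  -- equation.
  have hlin : ∀ a, |S a x + ∑ j, T a j x * v j| ≤ weightedAverage w Z H x * ‖v‖ ^ 2 := by
    intro a
    have h1 := abs_weightedAverage_le (x := x) (Z := Z) hw
      (g := fun z => G.score (b x) z a - G.score β z a - ∑ j, G.scoreJac β z a j * v j)
      (h := fun z => H z * ‖v‖ ^ 2) (fun i => by
        have := hxT i (b x) (Metric.ball_subset_ball (min_le_left _ _) hxU) a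
        rw [fderiv_apply_eq_sum] at this
        exact this)
    rw [weightedAverage_mul_const, weightedAverage_sub, weightedAverage_sub, hx0 a,
      weightedAverage_sum] at h1
    simp only [weightedAverage_mul_const] at h1
    rw [← abs_neg] at h1
    convert h1 using 2
    simp only [S, T]
    ring
  have hJv : ∀ a, |c * (J *ᵥ v) a| ≤ s + weightedAverage w Z H x * ‖v‖ ^ 2 + e * ‖v‖ := by
    intro a
    -- Since `T` tends to -cJ, this writes cJv as the score average at β, minus the Taylor
    -- remainder, plus a small multiple of v.
    have h1 : c * (J *ᵥ v) a =
        S a x - (S a x + ∑ j, T a j x * v j) + ∑ j, (T a j x + c * J a j) * v j := by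
      simp only [Matrix.mulVec, dotProduct, add_mul, Finset.sum_add_distrib, Finset.mul_sum]
      simp only [mul_assoc]
      ring
    have h2 : |∑ j, (T a j x + c * J a j) * v j| ≤ e * ‖v‖ := by
      calc _ ≤ ∑ j, |(T a j x + c * J a j) * v j| := Finset.abs_sum_le_sum_abs _ _
        _ ≤ ∑ j, |T a j x + c * J a j| * ‖v‖ := by
            refine Finset.sum_le_sum fun j _ => ?_
            rw [abs_mul]
            gcongr
            exact norm_le_pi_norm v j
        _ = (∑ j, |T a j x + c * J a j|) * ‖v‖ := by rw [Finset.sum_mul]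
        _ ≤ e * ‖v‖ := by
            gcongr
            exact Finset.single_le_sum (f := fun a => ∑ j, |T a j x + c * J a j|)
              (fun a _ => Finset.sum_nonneg fun j _ => abs_nonneg _) (Finset.mem_univ a)
    have h3 : |S a x| ≤ s :=
      Finset.single_le_sum (f := fun a => |S a x|) (fun a _ => abs_nonneg _) (Finset.mem_univ a)
    rw [h1]
    refine (abs_add_le _ _).trans (add_le_add ((abs_sub _ _).trans (add_le_add h3 (hlin a))) h2)
  have hs0 : 0 ≤ s := Finset.sum_nonneg fun a _ => abs_nonneg _
  have he0 : 0 ≤ e := Finset.sum_nonneg fun a _ => Finset.sum_nonneg fun j _ => abs_nonneg _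
  have hnorm : c * ‖J *ᵥ v‖ ≤ s + weightedAverage w Z H x * ‖v‖ ^ 2 + e * ‖v‖ := by
    have : ‖c • (J *ᵥ v)‖ ≤ s + weightedAverage w Z H x * ‖v‖ ^ 2 + e * ‖v‖ :=
      (pi_norm_le_iff_of_nonneg (by positivity)).2 fun a => hJv a
    rwa [norm_smul, Real.norm_of_nonneg hc.le] at this
  have hquad : κ * (weightedAverage w Z H x * ‖v‖ ^ 2) ≤ c / 4 * ‖v‖ := by
    have h1 : κ * (h + 1) * ‖v‖ ≤ c / 4 := by
      have : ‖v‖ ≤ c / (4 * κ * (h + 1)) := hvr.le.trans (min_le_right _ _)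
      calc κ * (h + 1) * ‖v‖ ≤ κ * (h + 1) * (c / (4 * κ * (h + 1))) := by gcongr
        _ = c / 4 := by field_simp
    calc κ * (weightedAverage w Z H x * ‖v‖ ^ 2) ≤ κ * ((h + 1) * ‖v‖ ^ 2) := by gcongr
      _ = κ * (h + 1) * ‖v‖ * ‖v‖ := by ring
      _ ≤ c / 4 * ‖v‖ := by gcongr
  have hEv : κ * (e * ‖v‖) ≤ c / 4 * ‖v‖ := by
    rw [← mul_assoc]; gcongr
  -- The remainder and the error of `T` each cost c/4 · ‖v‖; together they are absorbed by the left
  -- side, leaving ‖v‖ bounded by a multiple of the score average at β.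
  have hfin : c * ‖v‖ ≤ κ * s + c / 2 * ‖v‖ := by
    calc c * ‖v‖ ≤ c * (κ * ‖J *ᵥ v‖) := by gcongr; exact hκJ v
      _ = κ * (c * ‖J *ᵥ v‖) := by ring
      _ ≤ κ * (s + weightedAverage w Z H x * ‖v‖ ^ 2 + e * ‖v‖) := by gcongr
      _ ≤ κ * s + c / 2 * ‖v‖ := by linarith
  have : ‖v‖ ≤ 2 * (κ * s) / c := by
    rw [le_div_iff₀ hc]
    linarith
  calc ‖v‖ ≤ 2 * (κ * s) / c := this
    _ = _ := by ring

end PlugIn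

/-! ### Continuity of inverse, sandwich and block constructions. -/

section Matrices

variable {X ι : Type*} [Fintype ι] [DecidableEq ι] {l : Filter X}

theorem tendsto_matrix_inv {F : X → Matrix ι ι ℝ} {S : Matrix ι ι ℝ} (hF : Tendsto F l (𝓝 S))
    (hS : IsUnit S.det) : Tendsto (fun x => (F x)⁻¹) l (𝓝 S⁻¹) := by
  simp only [Matrix.inv_def, Ring.inverse_eq_inv']
  refine Tendsto.smul (Tendsto.inv₀ ?_ hS.ne_zero) ?_
  · exact ((continuous_id.matrix_det).tendsto S).comp hF
  · exact ((continuous_id.matrix_adjugate).tendsto S).comp hF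

theorem tendsto_sandwich {F K : X → Matrix ι ι ℝ} {S L : Matrix ι ι ℝ}
    (hF : Tendsto F l (𝓝 S)) (hK : Tendsto K l (𝓝 L)) (hS : IsUnit S.det) :
    Tendsto (fun x => sandwich (F x) (K x)) l (𝓝 (sandwich S L)) := by
  have h := tendsto_matrix_inv hF hS
  have ht : Tendsto (fun x => ((F x)⁻¹)ᵀ) l (𝓝 (S⁻¹)ᵀ) :=
    ((continuous_id.matrix_transpose).tendsto S⁻¹).comp h
  exact (h.mul hK).mul ht

theorem tendsto_diagBlocks {M p : ℕ} {B : X → Fin M → Matrix (Fin p) (Fin p) ℝ}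
    {L : Fin M → Matrix (Fin p) (Fin p) ℝ} (h : ∀ r, Tendsto (fun x => B x r) l (𝓝 (L r))) :
    Tendsto (fun x => diagBlocks (B x)) l (𝓝 (diagBlocks L)) := by
  refine tendsto_pi_nhds.2 fun u => tendsto_pi_nhds.2 fun v => ?_
  by_cases huv : u.1 = v.1
  · simpa [diagBlocks, huv] using
      tendsto_pi_nhds.1 (tendsto_pi_nhds.1 (h v.1) u.2) v.2
  · simp [diagBlocks, huv, tendsto_const_nhds]

theorem tendsto_blocks {M p : ℕ} {B : X → Fin M → Fin M → Matrix (Fin p) (Fin p) ℝ}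
    {L : Fin M → Fin M → Matrix (Fin p) (Fin p) ℝ}
    (h : ∀ k r, Tendsto (fun x => B x k r) l (𝓝 (L k r))) :
    Tendsto (fun x => blocks (B x)) l (𝓝 (blocks L)) :=
  tendsto_pi_nhds.2 fun u => tendsto_pi_nhds.2 fun v =>
    tendsto_pi_nhds.1 (tendsto_pi_nhds.1 (h u.1 v.1) u.2) v.2

/-- Up to exchanging the two index components this is `Matrix.blockDiagonal`, whose determinant is
the product of the block determinants. -/
theorem isUnit_det_diagBlocks {M p : ℕ} {B : Fin M → Matrix (Fin p) (Fin p) ℝ}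
    (h : ∀ r, IsUnit (B r).det) : IsUnit (diagBlocks B).det := by
  have hB : diagBlocks B = (Matrix.blockDiagonal B).submatrix Prod.swap Prod.swap := by
    ext u v
    simp [diagBlocks, Matrix.blockDiagonal_apply]
  have : (diagBlocks B).det = (Matrix.blockDiagonal B).det := by
    rw [hB]
    exact Matrix.det_submatrix_equiv_self (Equiv.prodComm (Fin M) (Fin p)) _
  rw [this, Matrix.det_blockDiagonal]
  exact IsUnit.prod_univ_iff.2 h

end Matrices

/-! ### Interim averages and the estimands in terms of weighted averages. -/

section Interim

variable {Ω : Type*} {M d p : ℕ}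

/-- The interim average is the compound average rescaled by n/n_m; if no group has arrived, division
by zero makes both sides 0. -/
theorem smul_sum_filter_arrived (A : (n : ℕ) → Fin n → Ω → Fin M) (n : ℕ) (m : Fin M) (ω : Ω)
    (B : Fin n → Matrix (Fin p) (Fin p) ℝ) :
    (1 / (numArrived A n m ω : ℝ)) • ∑ i ∈ Finset.univ.filter (fun i : Fin n => A n i ω ≤ m), B i =
      ((n : ℝ) / numArrived A n m ω) • (1 / (n : ℝ)) • ∑ i, arrived A n i m ω • B i := by
  have h : ∑ i, arrived A n i m ω • B i =
      ∑ i ∈ Finset.univ.filter (fun i : Fin n => A n i ω ≤ m), B i := by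
    rw [Finset.sum_filter]
    refine Finset.sum_congr rfl fun i _ => ?_
    unfold arrived
    split_ifs <;> simp
  rw [h, smul_smul]
  rcases Nat.eq_zero_or_pos n with rfl | hn
  · simp
  · have : (n : ℝ) ≠ 0 := by positivity
    congr 1
    field_simp

theorem average_arrived_smul (A : (n : ℕ) → Fin n → Ω → Fin M) (Z : ℕ → Ω → GroupData d)
    (m : Fin M) (x : ℕ × Ω) (f : GroupData d → Matrix (Fin p) (Fin p) ℝ) (a j : Fin p) :
    ((1 / (x.1 : ℝ)) • ∑ i : Fin x.1, arrived A x.1 i m x.2 • f (Z i x.2)) a j =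
      weightedAverage (fun n i => arrived A n i m) Z (fun z => f z a j) x := by
  simp [weightedAverage, Matrix.sum_apply]

end Interim

section Estimands

variable {Ω : Type*} [MeasurableSpace Ω] {P : Measure Ω} [IsProbabilityMeasure P] {d : ℕ}
  {Q : Measure (GroupData d)} [IsFiniteMeasure Q] {Z : ℕ → Ω → GroupData d}
  {w : (n : ℕ) → Fin n → Ω → ℝ} {c : ℝ}

theorem WeightedLLN.tendsto_condExp (hLLN : WeightedLLN P Q w Z c)
    (hZ : ∀ i, Measurable (Z i)) (hlaw : ∀ i, P.map (Z i) = Q) {f : GroupData d → ℝ}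
    (hf : Integrable f Q) :
    Tendsto (fun x : ℕ × Ω => (1 / (x.1 : ℝ)) * ∑ i : Fin x.1, w x.1 i x.2 *
      (P[fun ω' => f (Z i ω') |
        MeasurableSpace.comap (fun ω' => (Z i ω').cov) inferInstance]) x.2)
      (probFilter P) (𝓝 (c * ∫ z, f z ∂Q)) := by
  have h := hLLN (Q[f | MeasurableSpace.comap GroupData.cov inferInstance]) integrable_condExp
  rw [integral_condExp GroupData.measurable_cov.comap_le] at h
  refine h.congr' ?_
  have hev : ∀ᶠ x : ℕ × Ω in probFilter P, ∀ i : ℕ, (P[fun ω' => f (Z i ω') |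
      MeasurableSpace.comap (fun ω' => (Z i ω').cov) inferInstance]) x.2 =
      (Q[f | MeasurableSpace.comap GroupData.cov inferInstance]) (Z i x.2) :=
    eventually_probFilter_of_ae fun n => ae_all_iff.2 fun i =>
      condExp_comp_of_map_eq (hZ i) (hlaw i) GroupData.measurable_cov hf
  filter_upwards [hev] with x hx
  simp only [weightedAverage, hx]

end Estimands

/-! ### Assembly of the theorem. -/

theorem theorem1 {Ω : Type*} [MeasurableSpace Ω] (P : Measure Ω) [IsProbabilityMeasure P]
    {M d p : ℕ} (G : GEEModel d p) (Q : Measure (GroupData d)) (β : Fin p → ℝ)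
    (hG : G.Regular Q β)
    -- the groups are independent with common law `Q`
    (Z : ℕ → Ω → GroupData d) (hZ_meas : ∀ i, Measurable (Z i))
    (hZ_law : ∀ i, P.map (Z i) = Q) (hZ_indep : iIndepFun Z P)
    -- arrivals are independent of the data, and `π_m = E ξ_{im}` has a positive limit
    (A : (n : ℕ) → Fin n → Ω → Fin M) (hA_meas : ∀ n i, Measurable (A n i))
    (hA_data : ∀ n, IndepFun (fun ω (i : Fin n) => A n i ω) (fun ω (i : Fin n) => Z i ω) P)
    (π : ℕ → Fin M → ℝ) (hπ : ∀ n i m, ∫ ω, arrived A n i m ω ∂P = π n m)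
    (ϖ : Fin M → ℝ) (hϖ : ∀ m, Tendsto (fun n => π n m) atTop (𝓝 (ϖ m)))
    (hϖ_pos : ∀ m, 0 < ϖ m)
    -- groups arrive independently of one another, or the interim group counts are fixed
    (hA : (∀ n, iIndepFun (A n) P) ∨
      ∃ N : ℕ → Fin M → ℕ, ∀ n m, ∀ᵐ ω ∂P, numArrived A n m ω = N n m) :
    ∃ (Om : Fin M → Matrix (Fin p) (Fin p) ℝ) (La : Fin M → Fin M → Matrix (Fin p) (Fin p) ℝ),
      -- the estimands, as limits
      (∀ m, ConvergesInProb P (omegaAverage P G β Z A m) (Om m)) ∧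
      (∀ k r, ConvergesInProb P (lambdaAverage P G β Z A k r) (La k r)) ∧
      IsUnit (diagBlocks Om).det ∧
      ∃ U ∈ 𝓝 β, ∀ βh : ℕ → Ω → Fin M → Fin p → ℝ,
        -- the stacked estimators solve the compound equation and lie near `β`
        Tendsto (fun n => P {ω | ¬ ∑ i : Fin n,
          G.compoundScore (fun m => arrived A n i m ω) (βh n ω) (Z i ω) = 0}) atTop (𝓝 0) →
        (∀ m, Tendsto (fun n => P {ω | βh n ω m ∉ U}) atTop (𝓝 0)) →
        ∀ m : Fin M,
          (ConvergesInProb P (omegaTilde G Z A π βh m) (Om m) ∧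
            ConvergesInProb P (omegaHat G Z A βh m) (Om m)) ∧
          (ConvergesInProb P (lambdaTilde G Z A π βh m) (La m m) ∧
            ConvergesInProb P (lambdaHat G Z A βh m) (La m m)) ∧
          (∀ r, ConvergesInProb P (omegaInterim G Z A π βh m r) (Om r)) ∧
          (∀ k r, r ≤ k →
            ConvergesInProb P (lambdaInterim G Z A π βh m k r) (La k r) ∧
            ConvergesInProb P (lambdaInterim G Z A π βh m r k) (La r k)) ∧
          ConvergesInProb P
            (fun n ω => diagBlocks fun r => omegaInterim G Z A π βh m r n ω) (diagBlocks Om) ∧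
          ConvergesInProb P
            (fun n ω => blocks fun k r => lambdaInterim G Z A π βh m k r n ω) (blocks La) ∧
          ConvergesInProb P
            (fun n ω => sandwich (diagBlocks fun r => omegaInterim G Z A π βh m r n ω)
              (blocks fun k r => lambdaInterim G Z A π βh m k r n ω))
            (sandwich (diagBlocks Om) (blocks La)) := by
  have hQ : IsProbabilityMeasure Q := by
    rw [← hZ_law 0]; exact Measure.isProbabilityMeasure_map (hZ_meas 0).aemeasurable
  have hw : ∀ m n (i : Fin n) ω, 0 ≤ arrived A n i m ω := fun m n i ω => by
    unfold arrived; split_ifs <;> simp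
  have hcount := tendsto_average_arrived hA_meas hπ hϖ hA
  have hLLN : ∀ m, WeightedLLN P Q (fun n i => arrived A n i m) Z (ϖ m) := fun m g hg =>
    tendsto_weighted_average hZ_meas hZ_law hZ_indep hA_meas hA_data
      (φ := fun a => if a ≤ m then 1 else 0) (fun a => by split_ifs <;> simp) (hcount m) hg
  simp only [sum_arrived] at hcount
  have hinv : ∀ m, Tendsto (fun x : ℕ × Ω => (x.1 : ℝ) / numArrived A x.1 m x.2) (probFilter P)
      (𝓝 (ϖ m)⁻¹) := fun m =>
    ((hcount m).inv₀ (hϖ_pos m).ne').congr fun x => by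
      rw [one_div, mul_inv, inv_inv, div_eq_mul_inv]
  have hratio : ∀ m r, Tendsto (fun x : ℕ × Ω =>
      (numArrived A x.1 r x.2 : ℝ) / numArrived A x.1 m x.2) (probFilter P)
      (𝓝 (ϖ r * (ϖ m)⁻¹)) := fun m r => by
    refine ((hcount r).mul (hinv m)).congr' ?_
    filter_upwards [tendsto_fst_probFilter.eventually (eventually_gt_atTop 0)] with x hx
    have : (x.1 : ℝ) ≠ 0 := by positivity
    field_simp
  have hπ' : ∀ m, Tendsto (fun x : ℕ × Ω => π x.1 m) (probFilter P) (𝓝 (ϖ m)) := fun m =>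
    (hϖ m).comp tendsto_fst_probFilter
  set J : Matrix (Fin p) (Fin p) ℝ := Matrix.of fun a j => ∫ z, G.info β z a j ∂Q with hJ
  set K : Matrix (Fin p) (Fin p) ℝ := Matrix.of fun a j => ∫ z, G.meat β z a j ∂Q with hK
  have hK' : ∀ a j, K a j = ∫ z, G.score β z a * G.score β z j ∂Q := fun a j =>
    integral_congr_ae (hG.meat_eq a j)
  have hKsymm : Kᵀ = K := by
    ext a j
    rw [Matrix.transpose_apply, hK', hK']
    simp only [mul_comm]
  have hunit : IsUnit (diagBlocks fun m => ϖ m • J).det := isUnit_det_diagBlocks fun m => by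
    rw [Matrix.det_smul]
    exact ((hϖ_pos m).ne'.isUnit.pow _).mul hG.nonsingular
  refine ⟨fun m => ϖ m • J, fun k r => ϖ (min k r) • K, fun m a j => ?_, fun k r a j => ?_, hunit, ?_⟩
  · have h := (hG.integral_scoreJac a j)
    have h1 := ((hLLN m).tendsto_condExp hZ_meas hZ_law h.1).neg
    rw [h.2, mul_neg, neg_neg] at h1
    exact tendstoInMeasure_const_iff.2 h1
  · have h1 := (hLLN (min k r)).tendsto_condExp hZ_meas hZ_law
      ((hG.meat_dom a j).1.congr (hG.meat_eq a j))
    rw [← hK'] at h1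
    refine tendstoInMeasure_const_iff.2 (h1.congr fun x => ?_)
    simp only [lambdaAverage, Matrix.of_apply, arrived_mul_arrived]
  choose U hU hcons using fun m => hG.exists_nhds_consistent (hLLN m) (hϖ_pos m) hZ_meas hZ_law (hw m)
  -- One neighbourhood serves all analyses because there are finitely many.
  refine ⟨⋂ m, U m, iInter_mem.2 hU, fun βh hsol hnear => ?_⟩
  have hβ : ∀ m, Tendsto (fun x : ℕ × Ω => βh x.1 x.2 m) (probFilter P) (𝓝 β) := by
    intro m
    have hsol' : ∀ᶠ x : ℕ × Ω in probFilter P, ∑ i : Fin x.1, G.compoundScore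
        (fun m => arrived A x.1 i m x.2) (βh x.1 x.2) (Z i x.2) = 0 := hsol
    have hnear' : ∀ᶠ x : ℕ × Ω in probFilter P, βh x.1 x.2 m ∈ ⋂ m, U m := hnear m
    refine hcons m _ ?_ (hnear'.mono fun x hx => Set.mem_iInter.1 hx m)
    filter_upwards [hsol'] with x hx a
    have := congrFun hx (m, a)
    rw [Finset.sum_apply] at this
    exact mul_eq_zero_of_right _ this
  have hOhat : ∀ m, Tendsto (fun x : ℕ × Ω => omegaHat G Z A βh m x.1 x.2) (probFilter P)
      (𝓝 (ϖ m • J)) := fun m => tendsto_pi_nhds.2 fun a => tendsto_pi_nhds.2 fun j =>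
    ((hLLN m).tendsto_plugIn hZ_meas hZ_law (hw m) (hG.info_dom a j) (hβ m)).congr
      fun x => (average_arrived_smul A Z m x (G.info (βh x.1 x.2 m)) a j).symm
  have hLhat : ∀ m, Tendsto (fun x : ℕ × Ω => lambdaHat G Z A βh m x.1 x.2) (probFilter P)
      (𝓝 (ϖ m • K)) := fun m => tendsto_pi_nhds.2 fun a => tendsto_pi_nhds.2 fun j =>
    ((hLLN m).tendsto_plugIn hZ_meas hZ_law (hw m) (hG.meat_dom a j) (hβ m)).congr
      fun x => (average_arrived_smul A Z m x (G.meat (βh x.1 x.2 m)) a j).symm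
  have hcancel : ∀ (m : Fin M) (B : Matrix (Fin p) (Fin p) ℝ),
      ϖ m • (ϖ m)⁻¹ • ϖ m • B = ϖ m • B := fun m B => by
    rw [inv_smul_smul₀ (hϖ_pos m).ne']
  have hOt : ∀ m, Tendsto (fun x : ℕ × Ω => omegaTilde G Z A π βh m x.1 x.2) (probFilter P)
      (𝓝 (ϖ m • J)) := fun m => by
    rw [← hcancel]
    refine ((hπ' m).smul ((hinv m).smul (hOhat m))).congr fun x => ?_
    rw [omegaTilde, omegaStd, smul_sum_filter_arrived, omegaHat]
  have hLt : ∀ m, Tendsto (fun x : ℕ × Ω => lambdaTilde G Z A π βh m x.1 x.2) (probFilter P)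
      (𝓝 (ϖ m • K)) := fun m => by
    rw [← hcancel]
    refine ((hπ' m).smul ((hinv m).smul (hLhat m))).congr fun x => ?_
    rw [lambdaTilde, lambdaStd, smul_sum_filter_arrived, lambdaHat]
  intro m
  have hscale : ∀ (r : Fin M) (B : Matrix (Fin p) (Fin p) ℝ),
      (ϖ r * (ϖ m)⁻¹) • ϖ m • B = ϖ r • B := fun r B => by
    rw [mul_smul, inv_smul_smul₀ (hϖ_pos m).ne']
  have hOi : ∀ r, Tendsto (fun x : ℕ × Ω => omegaInterim G Z A π βh m r x.1 x.2) (probFilter P)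
      (𝓝 (ϖ r • J)) := fun r => by
    rw [← hscale]
    exact (hratio m r).smul (hOt m)
  have hLi : ∀ k r, Tendsto (fun x : ℕ × Ω => lambdaInterim G Z A π βh m k r x.1 x.2)
      (probFilter P) (𝓝 (ϖ (min k r) • K)) := fun k r => by
    have h : ∀ r, Tendsto (fun x : ℕ × Ω => ((numArrived A x.1 r x.2 : ℝ) /
        (numArrived A x.1 m x.2 : ℝ)) • lambdaTilde G Z A π βh m x.1 x.2) (probFilter P)
        (𝓝 (ϖ r • K)) := fun r => by
      rw [← hscale]
      exact (hratio m r).smul (hLt m)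
    by_cases hrk : r ≤ k
    · simp only [lambdaInterim, hrk, if_true, min_eq_right]
      exact h r
    · simp only [lambdaInterim, hrk, if_false, min_eq_left (not_le.1 hrk).le]
      -- For r > k the block is defined as a transpose; symmetry of K gives it the same limit ϖ_k K.
      rw [← hKsymm, ← Matrix.transpose_smul]
      exact ((continuous_id.matrix_transpose).tendsto (ϖ k • K)).comp (h k)
  have hOd := tendsto_diagBlocks hOi
  have hLb := tendsto_blocks hLi
  refine ⟨⟨convergesInProb_iff.2 (hOt m), convergesInProb_iff.2 (hOhat m)⟩,
    ⟨convergesInProb_iff.2 ?_, convergesInProb_iff.2 ?_⟩, fun r => convergesInProb_iff.2 (hOi r),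
    fun k r _ => ⟨convergesInProb_iff.2 (hLi k r), convergesInProb_iff.2 (hLi r k)⟩,
    convergesInProb_iff.2 hOd, convergesInProb_iff.2 hLb,
    convergesInProb_iff.2 (tendsto_sandwich hOd hLb hunit)⟩
  · simpa only [min_self] using hLt m
  · simpa only [min_self] using hLhat m
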